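/- For integers $t\ge 1$, $n\ge 1$ let $\tau_t(n)=\#\{(d_1,\ldots,d_t)\in\mathbb{N}^t: d_1\cdots d_t=n\}$ be the Piltz divisor function. For $t\ge 2$ let $\vartheta_t$ be the exponent in the Piltz divisor problem for $\tau_t$, that is, the infimum of the real numbers $\theta$ for which there is a real polynomial $P_t$ of degree $t-1$ with leading coefficient $1/(t-1)!$ such that, for every $\varepsilon>0$, $\sum_{n\le x}\tau_t(n)=xP_t(\log x)+O(x^{\theta+\varepsilon})$ as $x\to\infty$. Let $r\ge 2$ and let $t_1,\ldots,t_r\ge 2$ be fixed integers. Then there is a real polynomial $\overline{Q}$, independent of $\varepsilon$, of degree $t_1+\cdots+t_r-r$ and with leading coefficient $$\frac{\overline{\Delta}(\tau_{t_1},\ldots,\tau_{t_r},1,\ldots,1)}{(t_1-1)!\cdots(t_r-1)!},$$ such that for every $\varepsilon>0$, as $x\to\infty$, $$\sum_{\substack{n_1,\ldots,n_r\le x\\ \gcd(n_i,n_j)=1\ (i\ne j)}}\tau_{t_1}(n_1)\cdots\tau_{t_r}(n_r)=x^r\,\overline{Q}(\log x)+O\bigl(x^{r-1+\max_{1\le i\le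 r}\vartheta_{t_i}+\varepsilon}\bigr),$$ where the implied constant may depend on $r,t_1,\ldots,t_r,\varepsilon$. Here $$\overline{\Delta}(\tau_{t_1},\ldots,\tau_{t_r},1,\ldots,1)=\prod_p\biggl(1-\sum_{i=2}^r(i-1)\sum_{1\le\ell_1<\cdots<\ell_i\le r}\ \sum_{a_{\ell_1}=1}^{t_{\ell_1}}\cdots\sum_{a_{\ell_i}=1}^{t_{\ell_i}}\frac{1}{p^{a_{\ell_1}+\cdots+a_{\ell_i}}}\prod_{m=1}^i(-1)^{a_{\ell_m}}\binom{t_{\ell_m}}{a_{\ell_m}}\biggr),$$ the product being over all primes $p$ and converging unconditionally. -/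

import Mathlib

open Filter Asymptotics Finset Polynomial

/-- The Piltz divisor function `τ_t(n)`: the number of ordered `t`-tuples of positive integers
with product `n`. (`Nat.finMulAntidiag t n` is the finset of all functions `Fin t → ℕ` with
product `n` if `n ≠ 0`, and is empty for `n = 0`.) -/
def piltzTau (t n : ℕ) : ℕ := (Nat.finMulAntidiag t n).card

/-- `θ` is an admissible exponent in the Piltz divisor problem for `τ_t`: for some real polynomial
`P` of degree `t - 1` with leading coefficient `1 / (t - 1)!` one has, for every `ε > 0`,
`∑_{n ≤ x} τ_t(n) = x P(log x) + O(x ^ (θ + ε))` as `x → ∞`. -/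
def IsPiltzAdmissible (t : ℕ) (θ : ℝ) : Prop :=
  ∃ P : ℝ[X], P.natDegree = t - 1 ∧ P.leadingCoeff = 1 / ((t - 1).factorial : ℝ) ∧
    ∀ ε : ℝ, 0 < ε →
      (fun x : ℝ => (∑ n ∈ Finset.Icc 1 ⌊x⌋₊, (piltzTau t n : ℝ)) - x * P.eval (Real.log x))
        =O[atTop] fun x : ℝ => x ^ (θ + ε)

/-- The exponent `ϑ_t` in the Piltz divisor problem for `τ_t`: the infimum of all admissible
exponents. (For `t ≥ 2` this set contains `1`, and it is bounded below by `0` because the summatory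
function of `τ_t` jumps by at least `1` at every positive integer.) -/
noncomputable def piltzExponent (t : ℕ) : ℝ := sInf {θ : ℝ | IsPiltzAdmissible t θ}

/-- The sum of `τ_{t_1}(n_1) ⋯ τ_{t_r}(n_r)` over all positive integers `n_1, …, n_r ≤ x`
that are pairwise relatively prime. -/
noncomputable def pairwiseCoprimeTauSum {r : ℕ} (t : Fin r → ℕ) (x : ℝ) : ℝ :=
  ∑ n ∈ (Fintype.piFinset fun _ : Fin r => Finset.Icc 1 ⌊x⌋₊) with
      ∀ i j, i ≠ j → Nat.Coprime (n i) (n j),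
    ∏ i, (piltzTau (t i) (n i) : ℝ)

/-- The factor at `p` of the Euler product `Δ̄(τ_{t_1}, …, τ_{t_r}, s_1, …, s_r)` at
`s_1 = ⋯ = s_r = 1`. The set `L = {ℓ_1 < ⋯ < ℓ_i}` runs over the `i`-element subsets of the index
set, and `a` over the families of exponents `a_ℓ`, `ℓ ∈ L`, with `1 ≤ a_ℓ ≤ t_ℓ` (larger exponents
would contribute `0`, since then `t_ℓ.choose a_ℓ = 0`). -/
noncomputable def deltaBarFactor {r : ℕ} (t : Fin r → ℕ) (p : ℕ) : ℝ :=
  1 - ∑ i ∈ Finset.Icc 2 r, ((i : ℝ) - 1) *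
    ∑ L ∈ Finset.powersetCard i (Finset.univ : Finset (Fin r)),
      ∑ a ∈ Fintype.piFinset (fun l : L => Finset.Icc 1 (t l)),
        1 / (p : ℝ) ^ (∑ l, a l) * ∏ l : L, (-1 : ℝ) ^ a l * ((t l).choose (a l) : ℝ)

/-- `Δ̄(τ_{t_1}, …, τ_{t_r}, 1, …, 1)`: the product of the factors over all primes. -/
noncomputable def deltaBar {r : ℕ} (t : Fin r → ℕ) : ℝ :=
  ∏' p : Nat.Primes, deltaBarFactor t (p : ℕ)

/-! Restricting `τ_{t_1} ⊗ ⋯ ⊗ τ_{t_r}` to pairwise coprime tuples is a multiplicative operation. At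
a prime `p` the generating series of the restricted function is `1 + ∑_j ((1 - x_j)^{-t_j} - 1)`,
since at most one coordinate is divisible by `p`. Dividing by `∏ (1 - x_i)^{-t_i}` leaves a
polynomial whose coefficient at `e` is `(1 - #{i | e i ≠ 0}) ∏ (-1)^{e_i} (t_i choose e_i)`. So the
restricted function is the convolution of `τ_{t_1} ⊗ ⋯ ⊗ τ_{t_r}` with the multiplicative function
`g = coprimeCoeff t` having these local values (`convolution_coprimeCoeff`), and the sum becomes
`∑_d g(d) ∏_i T_i(x / d_i)` with `T_i` the summatory function of `τ_{t_i}`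
(`pairwiseCoprimeTauSum_eq_tsum`).

The factor `1 - #{i | e i ≠ 0}` kills all exponent vectors with exactly one nonzero entry. Hence `∑
|g(d)| ∏ d_i^{-s_i}` converges as soon as the `s_i` are nonnegative and the sums `s_i + s_j`, `i ≠
j`, stay above some `σ > 1` (`summable_coprimeTerm`). This leaves room to save a power of `x` in one
variable at a time.

Each `T_i(y)` is replaced by `y P_i(log y)`, with an error `O(y^α)` valid for all `y > 0`, where `α`
lies slightly above the largest exponent. Telescoping the product gives the error bound
(`exists_abs_tsum_sub_tsum_le`). The main term is `x^r` times an infinite sum of polynomials in `log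
x` of bounded degree, hence `x^r` times a polynomial (`exists_mainTerm`). Its top coefficient is `∑
g(d) / ∏ d_i` times the product of the leading coefficients of the `P_i`, and this series is the
Euler product `deltaBar` (`deltaBar_eq_tsum`), which is positive, so the degree does not drop.

If the largest exponent is at least `1`, the trivial bound suffices and any polynomial of the right
shape works; the estimate `ϑ_t < 1` is therefore never needed. -/

open scoped ArithmeticFunction.zeta ArithmeticFunction.Moebius Topology

/-! ### Powers of the zeta and Möbius functions -/

lemma Nat.card_finMulAntidiag_succ (t n : ℕ) :
    (Nat.finMulAntidiag (t + 1) n).card =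
      ∑ x ∈ n.divisorsAntidiagonal, (Nat.finMulAntidiag t x.2).card := by
  rw [← Finset.card_sigma]
  refine Finset.card_nbij' (fun f => ⟨(f 0, ∏ i : Fin t, f i.succ), fun i => f i.succ⟩)
    (fun y => Fin.cons y.1.1 y.2) ?_ ?_ ?_ ?_
  · intro f hf
    have h := Nat.mem_finMulAntidiag.1 hf
    simp only [Fin.prod_univ_succ] at h
    have h0 : n ≠ 0 := h.2
    simp only [coe_sigma, Set.mem_sigma_iff, Finset.mem_coe, Nat.mem_divisorsAntidiagonal,
      Nat.mem_finMulAntidiag, true_and]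
    refine ⟨h, fun h1 => h0 ?_⟩
    rw [← h.1, h1, mul_zero]
  · rintro ⟨⟨a, b⟩, f⟩ hf
    simp only [coe_sigma, Set.mem_sigma_iff, Finset.mem_coe, Nat.mem_divisorsAntidiagonal,
      Nat.mem_finMulAntidiag] at hf
    simp only [Finset.mem_coe, Nat.mem_finMulAntidiag, Fin.prod_univ_succ, Fin.cons_zero,
      Fin.cons_succ, hf.2.1]
    exact hf.1
  · intro f _
    ext i
    refine Fin.cases ?_ (fun i => ?_) i <;> simp
  · rintro ⟨⟨a, b⟩, f⟩ hf
    simp only [coe_sigma, Set.mem_sigma_iff, Finset.mem_coe, Nat.mem_divisorsAntidiagonal,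
      Nat.mem_finMulAntidiag] at hf
    simp [hf.2.1]

lemma piltzTau_eq_zeta_pow {R : Type*} [CommSemiring R] (t n : ℕ) :
    (piltzTau t n : R) = ((ζ : ArithmeticFunction R) ^ t) n := by
  induction t generalizing n with
  | zero =>
    rw [piltzTau, pow_zero, ArithmeticFunction.one_apply]
    split_ifs with h
    · rw [h, Nat.finMulAntidiag_one]; simp
    · simp [Nat.finMulAntidiag_zero_left h]
  | succ t ih =>
    rw [piltzTau, Nat.card_finMulAntidiag_succ, pow_succ', ArithmeticFunction.mul_apply]
    push_cast
    refine Finset.sum_congr rfl fun x hx => ?_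
    have hx0 : x.1 ≠ 0 := (Nat.ne_zero_of_mem_divisorsAntidiagonal hx).1
    rw [← ih, ArithmeticFunction.natCoe_apply, ArithmeticFunction.zeta_apply_ne hx0]
    simp [piltzTau]

lemma ArithmeticFunction.mul_apply_prime_pow {R : Type*} [Semiring R] (f g : ArithmeticFunction R)
    {p : ℕ} (hp : p.Prime) (k : ℕ) :
    (f * g) (p ^ k) = ∑ e ∈ range (k + 1), f (p ^ e) * g (p ^ (k - e)) := by
  rw [ArithmeticFunction.mul_apply, Nat.sum_divisorsAntidiagonal (fun a b => f a * g b),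
    Nat.sum_divisors_prime_pow hp]
  refine Finset.sum_congr rfl fun e he => ?_
  rw [Nat.pow_div (by simp at he; omega) hp.pos]

/-- The local series of `μ` is `1 - X`, so these are the coefficients of `(1 - X)^t`; the induction
is Pascal's rule. -/
lemma moebius_pow_prime_pow (t : ℕ) {p : ℕ} (hp : p.Prime) (k : ℕ) :
    ((μ : ArithmeticFunction ℝ) ^ t) (p ^ k) = (-1) ^ k * (t.choose k : ℝ) := by
  induction t generalizing k with
  | zero =>
    rw [pow_zero, ArithmeticFunction.one_apply]
    cases k <;> simp [hp.ne_one]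
  | succ t ih =>
    rw [pow_succ', ArithmeticFunction.mul_apply_prime_pow _ _ hp]
    cases k with
    | zero => simpa using ih 0
    | succ k =>
      rw [Finset.sum_range_succ', Finset.sum_range_succ']
      -- Only `e = 0` and `e = 1` survive, because `μ (p ^ e) = 0` for `e ≥ 2`.
      rw [Finset.sum_eq_zero]
      · simp only [zero_add, pow_one, pow_zero, tsub_zero, Nat.add_sub_cancel, ih,
          ArithmeticFunction.intCoe_apply, ArithmeticFunction.moebius_apply_prime hp,
          ArithmeticFunction.moebius_apply_one, Nat.choose_succ_succ]
        push_cast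
        ring
      · intro e _
        rw [ArithmeticFunction.intCoe_apply, ArithmeticFunction.moebius_apply_prime_pow hp (by omega),
          if_neg (by omega)]
        simp

lemma sum_moebius_pow_mul_zeta_pow (t : ℕ) {p : ℕ} (hp : p.Prime) (v : ℕ) :
    ∑ e ∈ range (v + 1), ((μ : ArithmeticFunction ℝ) ^ t) (p ^ e) *
      ((ζ : ArithmeticFunction ℝ) ^ t) (p ^ (v - e)) = if v = 0 then 1 else 0 := by
  rw [← ArithmeticFunction.mul_apply_prime_pow _ _ hp, ← mul_pow,
    ArithmeticFunction.coe_moebius_mul_coe_zeta, one_pow, ArithmeticFunction.one_apply]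
  simp [hp.ne_one]

/-! ### Multiplicative functions of several variables -/

/-- A function of several positive integer variables is multiplicative if its value at `1` is `1`
and it is multiplicative on pairs of tuples whose products are coprime. -/
structure TupleMultiplicative {ι : Type*} (F : (ι → ℕ) → ℝ) : Prop where
  map_one : F 1 = 1
  map_mul : ∀ m n : ι → ℕ, (∀ i, m i ≠ 0) → (∀ i, n i ≠ 0) → (∀ i j, (m i).Coprime (n j)) →
    F (m * n) = F m * F n

/-- The tuple of powers of `p` with exponents `e`. -/
def tuplePow {ι : Type*} (p : ℕ) (e : ι → ℕ) : ι → ℕ := fun i => p ^ e i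

/-- The tuples that divide `n` in each coordinate. -/
def tupleDivisors {ι : Type*} [Fintype ι] [DecidableEq ι] (n : ι → ℕ) : Finset (ι → ℕ) :=
  Fintype.piFinset fun i => (n i).divisors

section Tuple

variable {ι : Type*}

lemma tuplePow_ne_zero {p : ℕ} (hp : p.Prime) (e : ι → ℕ) (i : ι) : tuplePow p e i ≠ 0 :=
  pow_ne_zero _ hp.ne_zero

lemma prod_tuplePow_apply (S : Finset ℕ) (e : ℕ → ι → ℕ) (i : ι) :
    (∏ p ∈ S, tuplePow p (e p)) i = ∏ p ∈ S, p ^ e p i := by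
  simp [tuplePow]

lemma TupleMultiplicative.map_prod {F : (ι → ℕ) → ℝ} (hF : TupleMultiplicative F)
    (S : Finset ℕ) (hS : ∀ p ∈ S, p.Prime) (e : ℕ → ι → ℕ) :
    F (∏ p ∈ S, tuplePow p (e p)) = ∏ p ∈ S, F (tuplePow p (e p)) := by
  induction S using Finset.induction_on with
  | empty => simpa using hF.map_one
  | insert q S hq ih =>
    have hS' : ∀ p ∈ S, p.Prime := fun p hp => hS p (Finset.mem_insert_of_mem hp)
    have hq' : q.Prime := hS q (Finset.mem_insert_self _ _)
    rw [Finset.prod_insert hq, Finset.prod_insert hq, ← ih hS']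
    refine hF.map_mul _ _ (tuplePow_ne_zero hq' _) (fun i => ?_) (fun i j => ?_)
    · rw [prod_tuplePow_apply]
      exact Finset.prod_ne_zero_iff.2 fun p hp => pow_ne_zero _ (hS' p hp).ne_zero
    · rw [prod_tuplePow_apply]
      refine Nat.Coprime.prod_right fun p hp => Nat.Coprime.pow _ _ ?_
      exact (Nat.coprime_primes hq' (hS' p hp)).2 fun h => hq (h ▸ hp)

lemma eq_prod_tuplePow [Fintype ι] (n : ι → ℕ) (hn : ∀ i, n i ≠ 0) :
    n = ∏ p ∈ (∏ i, n i).primeFactors, tuplePow p (fun i => (n i).factorization p) := by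
  ext i
  rw [prod_tuplePow_apply]
  conv_lhs => rw [← Nat.prod_factorization_pow_eq_self (hn i)]
  refine Finsupp.prod_of_support_subset _ ?_ _ (by simp)
  rw [Nat.support_factorization]
  exact Nat.primeFactors_mono (Finset.dvd_prod_of_mem _ (Finset.mem_univ i))
    (Finset.prod_ne_zero_iff.2 fun i _ => hn i)

lemma TupleMultiplicative.eq_of_prime_pow [Fintype ι] {F G : (ι → ℕ) → ℝ}
    (hF : TupleMultiplicative F) (hG : TupleMultiplicative G)
    (h : ∀ (p : ℕ) (v : ι → ℕ), p.Prime → F (tuplePow p v) = G (tuplePow p v))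
    (n : ι → ℕ) (hn : ∀ i, n i ≠ 0) : F n = G n := by
  have hS : ∀ p ∈ (∏ i, n i).primeFactors, p.Prime := fun p hp => Nat.prime_of_mem_primeFactors hp
  rw [eq_prod_tuplePow n hn, hF.map_prod _ hS, hG.map_prod _ hS]
  exact Finset.prod_congr rfl fun p hp => h _ _ (hS p hp)

lemma TupleMultiplicative.mul {F G : (ι → ℕ) → ℝ} (hF : TupleMultiplicative F)
    (hG : TupleMultiplicative G) : TupleMultiplicative (fun n => F n * G n) where
  map_one := by simp [hF.map_one, hG.map_one]
  map_mul m n hm hn h := by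
    rw [hF.map_mul m n hm hn h, hG.map_mul m n hm hn h]; ring

lemma TupleMultiplicative.abs {F : (ι → ℕ) → ℝ} (hF : TupleMultiplicative F) :
    TupleMultiplicative (fun n => |F n|) where
  map_one := by simp [hF.map_one]
  map_mul m n hm hn h := by rw [hF.map_mul m n hm hn h, abs_mul]

lemma tupleMultiplicative_prod [Fintype ι] (f : ι → ArithmeticFunction ℝ)
    (hf : ∀ i, (f i).IsMultiplicative) : TupleMultiplicative (fun n : ι → ℕ => ∏ i, f i (n i)) where
  map_one := by simp [(hf _).map_one]
  map_mul m n hm hn h := by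
    rw [← Finset.prod_mul_distrib]
    exact Finset.prod_congr rfl fun i _ => (hf i).map_mul_of_coprime (h i i)

lemma tupleMultiplicative_prod_rpow [Fintype ι] (s : ι → ℝ) :
    TupleMultiplicative (fun n : ι → ℕ => ∏ i, (n i : ℝ) ^ s i) where
  map_one := by simp
  map_mul m n hm hn h := by
    rw [← Finset.prod_mul_distrib]
    refine Finset.prod_congr rfl fun i _ => ?_
    rw [Pi.mul_apply, Nat.cast_mul, Real.mul_rpow (Nat.cast_nonneg _) (Nat.cast_nonneg _)]

variable [Fintype ι]

/-! ### The coefficients of the Dirichlet series attached to pairwise coprimality -/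

/-- The product over all primes `p` of `1 - #{i | p ∣ d i}`, where primes dividing no `d i`
contribute `1`. -/
noncomputable def coprimalityKernel (d : ι → ℕ) : ℝ :=
  ∏ p ∈ (∏ i, d i).primeFactors, (1 - (#{i | p ∣ d i} : ℝ))

/-- The coefficients `g` for which `τ_{t_1}(n_1) ⋯ τ_{t_r}(n_r)`, restricted to pairwise coprime
tuples, is the convolution of `g` with `τ_{t_1} ⊗ ⋯ ⊗ τ_{t_r}`. -/
noncomputable def coprimeCoeff (t d : ι → ℕ) : ℝ :=
  coprimalityKernel d * ∏ i, ((μ : ArithmeticFunction ℝ) ^ t i) (d i)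

lemma tupleMultiplicative_coprimalityKernel :
    TupleMultiplicative (coprimalityKernel : (ι → ℕ) → ℝ) where
  map_one := by simp [coprimalityKernel]
  map_mul m n hm hn h := by
    have hc : (∏ i, m i).Coprime (∏ i, n i) :=
      Nat.Coprime.prod_left fun i _ => Nat.Coprime.prod_right fun j _ => h i j
    simp only [coprimalityKernel, Pi.mul_apply, Finset.prod_mul_distrib]
    rw [hc.primeFactors_mul, Finset.prod_union hc.disjoint_primeFactors]
    congr 1
    · refine Finset.prod_congr rfl fun p hp => ?_
      have hp' := Nat.prime_of_mem_primeFactors hp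
      have : ∀ i, p ∣ m i * n i ↔ p ∣ m i := fun i => by
        refine ⟨fun hd => (hp'.dvd_mul.1 hd).resolve_right fun hd => ?_, fun hd => hd.mul_right _⟩
        exact Nat.not_coprime_of_dvd_of_dvd hp'.one_lt (Nat.dvd_of_mem_primeFactors hp)
          (hd.trans (Finset.dvd_prod_of_mem _ (Finset.mem_univ i))) hc
      simp only [this]
    · refine Finset.prod_congr rfl fun p hp => ?_
      have hp' := Nat.prime_of_mem_primeFactors hp
      have : ∀ i, p ∣ m i * n i ↔ p ∣ n i := fun i => by
        refine ⟨fun hd => (hp'.dvd_mul.1 hd).resolve_left fun hd => ?_, fun hd => hd.mul_left _⟩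
        exact Nat.not_coprime_of_dvd_of_dvd hp'.one_lt
          (hd.trans (Finset.dvd_prod_of_mem _ (Finset.mem_univ i)))
          (Nat.dvd_of_mem_primeFactors hp) hc
      simp only [this]

lemma coprimalityKernel_tuplePow {p : ℕ} (hp : p.Prime) (e : ι → ℕ) :
    coprimalityKernel (tuplePow p e) = 1 - (#{i | e i ≠ 0} : ℝ) := by
  have h : ∀ i, p ∣ tuplePow p e i ↔ e i ≠ 0 := fun i => by
    rw [tuplePow]
    exact ⟨fun hd h0 => hp.one_lt.ne' (by simpa [h0] using hd), fun h0 => dvd_pow_self _ h0⟩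
  have h1 : ∏ i, tuplePow p e i = p ^ ∑ i, e i := Finset.prod_pow_eq_pow_sum _ _ _
  rw [coprimalityKernel, h1]
  by_cases h0 : ∑ i, e i = 0
  · rw [h0]
    have : ∀ i, e i = 0 := fun i => Finset.sum_eq_zero_iff.1 h0 i (Finset.mem_univ i)
    simp [this]
  · rw [Nat.primeFactors_prime_pow h0 hp, Finset.prod_singleton]
    simp only [h]

lemma tupleMultiplicative_coprimeCoeff (t : ι → ℕ) : TupleMultiplicative (coprimeCoeff t) :=
  tupleMultiplicative_coprimalityKernel.mul (tupleMultiplicative_prod _ fun _ =>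
    ArithmeticFunction.isMultiplicative_moebius.intCast.pow)

lemma coprimeCoeff_tuplePow (t : ι → ℕ) {p : ℕ} (hp : p.Prime) (e : ι → ℕ) :
    coprimeCoeff t (tuplePow p e) =
      (1 - (#{i | e i ≠ 0} : ℝ)) * ∏ i, ((-1) ^ e i * ((t i).choose (e i) : ℝ)) := by
  rw [coprimeCoeff, coprimalityKernel_tuplePow hp]
  simp only [tuplePow, moebius_pow_prime_pow _ hp]

/-- Arithmetic functions vanish at `0`. This lets later series run over all of `ι → ℕ`, the junk
values of `x / 0` and `log 0` being multiplied by zero. -/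
lemma coprimeCoeff_eq_zero (t : ι → ℕ) {d : ι → ℕ} {i : ι} (hi : d i = 0) :
    coprimeCoeff t d = 0 := by
  rw [coprimeCoeff, Finset.prod_eq_zero (Finset.mem_univ i) (by rw [hi]; simp), mul_zero]

/-! ### Divisor sums over tuples -/

variable [DecidableEq ι]

lemma mem_tupleDivisors {n d : ι → ℕ} : d ∈ tupleDivisors n ↔ ∀ i, d i ∣ n i ∧ n i ≠ 0 := by
  simp [tupleDivisors]

lemma sum_tupleDivisors_mul {m n : ι → ℕ} (hm : ∀ i, m i ≠ 0) (hn : ∀ i, n i ≠ 0)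
    (h : ∀ i, (m i).Coprime (n i)) (φ : (ι → ℕ) → ℝ) :
    ∑ d ∈ tupleDivisors (m * n), φ d =
      ∑ a ∈ tupleDivisors m, ∑ b ∈ tupleDivisors n, φ (a * b) := by
  rw [← Finset.sum_product']
  -- By coprimality each divisor of `m i * n i` splits uniquely as its gcd with `m i` times its gcd
  -- with `n i`.
  refine Finset.sum_nbij' (fun d => (fun i => (d i).gcd (m i), fun i => (d i).gcd (n i)))
    (fun x => x.1 * x.2) ?_ ?_ ?_ ?_ ?_
  · intro d _
    simp only [Finset.mem_product, mem_tupleDivisors]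
    exact ⟨fun i => ⟨Nat.gcd_dvd_right _ _, hm i⟩, fun i => ⟨Nat.gcd_dvd_right _ _, hn i⟩⟩
  · rintro ⟨a, b⟩ hx
    simp only [Finset.mem_product, mem_tupleDivisors] at hx ⊢
    exact fun i => ⟨mul_dvd_mul (hx.1 i).1 (hx.2 i).1, mul_ne_zero (hm i) (hn i)⟩
  · intro d hd
    rw [mem_tupleDivisors] at hd
    ext i
    simp only [Pi.mul_apply]
    rw [← (h i).gcd_mul]
    exact Nat.gcd_eq_left (hd i).1
  · rintro ⟨a, b⟩ hx
    simp only [Finset.mem_product, mem_tupleDivisors] at hx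
    simp only [Prod.mk.injEq]
    refine ⟨funext fun i => ?_, funext fun i => ?_⟩
    · have h1 : (b i).Coprime (m i) := ((h i).coprime_dvd_right (hx.2 i).1).symm
      rw [Pi.mul_apply, h1.gcd_mul_right_cancel, Nat.gcd_eq_left (hx.1 i).1]
    · have h1 : (a i).Coprime (n i) := (h i).coprime_dvd_left (hx.1 i).1
      rw [Pi.mul_apply, h1.gcd_mul_left_cancel, Nat.gcd_eq_left (hx.2 i).1]
  · intro d hd
    rw [mem_tupleDivisors] at hd
    congr 1
    ext i
    simp only [Pi.mul_apply]
    rw [← (h i).gcd_mul]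
    exact (Nat.gcd_eq_left (hd i).1).symm

lemma TupleMultiplicative.convolution {F T : (ι → ℕ) → ℝ} (hF : TupleMultiplicative F)
    (hT : TupleMultiplicative T) :
    TupleMultiplicative (fun n => ∑ d ∈ tupleDivisors n, F d * T (n / d)) where
  map_one := by
    have : tupleDivisors (1 : ι → ℕ) = {1} := by
      ext d
      simp [mem_tupleDivisors, funext_iff]
    rw [this, Finset.sum_singleton, hF.map_one]
    have h1 : (1 : ι → ℕ) / 1 = 1 := by ext; simp
    rw [h1, hT.map_one, one_mul]
  map_mul m n hm hn h := by
    rw [sum_tupleDivisors_mul hm hn (fun i => h i i), Finset.sum_mul_sum]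
    refine Finset.sum_congr rfl fun a ha => Finset.sum_congr rfl fun b hb => ?_
    rw [mem_tupleDivisors] at ha hb
    have ha0 : ∀ i, a i ≠ 0 := fun i => ne_zero_of_dvd_ne_zero (ha i).2 (ha i).1
    have hb0 : ∀ i, b i ≠ 0 := fun i => ne_zero_of_dvd_ne_zero (hb i).2 (hb i).1
    have hdiv : m * n / (a * b) = (m / a) * (n / b) := by
      ext i
      exact (Nat.div_mul_div_comm (ha i).1 (hb i).1).symm
    have hma : ∀ i, (m / a) i ∣ m i := fun i => Nat.div_dvd_of_dvd (ha i).1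
    have hnb : ∀ i, (n / b) i ∣ n i := fun i => Nat.div_dvd_of_dvd (hb i).1
    rw [hdiv, hF.map_mul a b ha0 hb0 (fun i j => ?_), hT.map_mul _ _
      (fun i => ne_zero_of_dvd_ne_zero (hm i) (hma i))
      (fun i => ne_zero_of_dvd_ne_zero (hn i) (hnb i)) (fun i j => ?_)]
    · ring
    · exact ((h i j).coprime_dvd_left (hma i)).coprime_dvd_right (hnb j)
    · exact ((h i j).coprime_dvd_left (ha i).1).coprime_dvd_right (hb j).1

lemma sum_tupleDivisors_tuplePow {p : ℕ} (hp : p.Prime) (v : ι → ℕ) (φ : (ι → ℕ) → ℝ) :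
    ∑ d ∈ tupleDivisors (tuplePow p v), φ d =
      ∑ e ∈ Fintype.piFinset (fun i => range (v i + 1)), φ (tuplePow p e) := by
  symm
  refine Finset.sum_nbij (tuplePow p) ?_ ?_ ?_ (fun _ _ => rfl)
  · intro e he
    rw [Fintype.mem_piFinset] at he
    rw [mem_tupleDivisors]
    exact fun i => ⟨pow_dvd_pow _ (by have := he i; simp at this; omega), tuplePow_ne_zero hp _ i⟩
  · intro e _ e' _ h
    ext i
    exact Nat.pow_right_injective hp.two_le (congrFun h i)
  · intro d hd
    rw [Finset.mem_coe, mem_tupleDivisors] at hd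
    choose e he hde using fun i => (Nat.dvd_prime_pow hp).1 (hd i).1
    refine ⟨e, ?_, (funext hde).symm⟩
    rw [Finset.mem_coe, Fintype.mem_piFinset]
    exact fun i => by have := he i; simp; omega

/-- Expansion of a product weighted by `1 - (number of nonzero exponents)`. -/
lemma sum_one_sub_card_mul_prod (n : ι → ℕ) (w : ι → ℕ → ℝ) :
    ∑ e ∈ Fintype.piFinset (fun i => range (n i + 1)), (1 - (#{i | e i ≠ 0} : ℝ)) * ∏ i, w i (e i) =
      ∏ i, ∑ k ∈ range (n i + 1), w i k -
        ∑ j, (∑ k ∈ range (n j + 1), w j k - w j 0) *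
          ∏ i ∈ univ.erase j, ∑ k ∈ range (n i + 1), w i k := by
  -- The count is a sum over `j` of indicators of `e j ≠ 0`. Absorbing the indicator into the `j`-th
  -- factor keeps every summand a product over coordinates, so the sums over `e` factor.
  have h1 : ∀ e : ι → ℕ, (1 - (#{i | e i ≠ 0} : ℝ)) * ∏ i, w i (e i) =
      ∏ i, w i (e i) - ∑ j, ∏ i, (if i = j ∧ e i = 0 then 0 else w i (e i)) := fun e => by
    rw [sub_mul, one_mul, Finset.card_filter]
    push_cast
    rw [Finset.sum_mul]
    congr 1
    refine Finset.sum_congr rfl fun j _ => ?_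
    by_cases hj : e j = 0
    · rw [Finset.prod_eq_zero (f := fun i => if i = j ∧ e i = 0 then (0 : ℝ) else w i (e i))
        (Finset.mem_univ j) (by simp [hj])]
      simp [hj]
    · rw [if_pos hj, one_mul]
      refine Finset.prod_congr rfl fun i _ => ?_
      rw [if_neg]
      rintro ⟨rfl, h⟩
      exact hj h
  simp only [h1]
  rw [Finset.sum_sub_distrib, Finset.sum_comm, Finset.prod_univ_sum]
  congr 1
  refine Finset.sum_congr rfl fun j _ => ?_
  rw [← Finset.prod_univ_sum (fun i => range (n i + 1))
    (fun i k => if i = j ∧ k = 0 then 0 else w i k),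
    ← Finset.mul_prod_erase _ _ (Finset.mem_univ j)]
  congr 1
  · rw [Finset.sum_range_succ', Finset.sum_range_succ' (w j)]
    simp
  · refine Finset.prod_congr rfl fun i hi => Finset.sum_congr rfl fun k _ => ?_
    simp [Finset.ne_of_mem_erase hi]

/-! ### The convolution identity for pairwise coprime tuples. -/

/-- The indicator of pairwise coprime tuples. -/
noncomputable def pairwiseCoprimeIndicator (n : ι → ℕ) : ℝ :=
  if ∀ i j, i ≠ j → Nat.Coprime (n i) (n j) then 1 else 0

lemma tupleMultiplicative_pairwiseCoprimeIndicator :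
    TupleMultiplicative (pairwiseCoprimeIndicator : (ι → ℕ) → ℝ) where
  map_one := by simp [pairwiseCoprimeIndicator]
  map_mul m n hm hn h := by
    have : (∀ i j, i ≠ j → Nat.Coprime ((m * n) i) ((m * n) j)) ↔
        (∀ i j, i ≠ j → Nat.Coprime (m i) (m j)) ∧ ∀ i j, i ≠ j → Nat.Coprime (n i) (n j) := by
      simp only [Pi.mul_apply, Nat.coprime_mul_iff_left, Nat.coprime_mul_iff_right]
      exact ⟨fun H => ⟨fun i j hij => (H i j hij).1.1, fun i j hij => (H i j hij).2.2⟩,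
        fun H i j hij => ⟨⟨H.1 i j hij, (h j i).symm⟩, ⟨h i j, H.2 i j hij⟩⟩⟩
    simp only [pairwiseCoprimeIndicator, this, ite_and]
    split_ifs <;> simp

/-- Both sides are multiplicative, so prime powers `p ^ v i` suffice. There `μ^t * ζ^t = 1` turns
the left side into `∏ [v_i = 0] + ∑_j (τ(p^{v_j}) - [v_j = 0]) ∏_{i ≠ j} [v_i = 0]`. This is `1` if
`v = 0`, `τ(p^{v_j})` if only `v_j` is nonzero, and `0` if two entries are nonzero. -/
lemma convolution_coprimeCoeff (t n : ι → ℕ) (hn : ∀ i, n i ≠ 0) :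
    ∑ d ∈ tupleDivisors n, coprimeCoeff t d *
      ∏ i, ((ζ : ArithmeticFunction ℝ) ^ t i) ((n / d) i) =
      pairwiseCoprimeIndicator n * ∏ i, ((ζ : ArithmeticFunction ℝ) ^ t i) (n i) := by
  have hz : TupleMultiplicative
      (fun n : ι → ℕ => ∏ i, ((ζ : ArithmeticFunction ℝ) ^ t i) (n i)) :=
    tupleMultiplicative_prod _ fun _ => ArithmeticFunction.isMultiplicative_zeta.natCast.pow
  refine ((tupleMultiplicative_coprimeCoeff t).convolution hz).eq_of_prime_pow
    (tupleMultiplicative_pairwiseCoprimeIndicator.mul hz) (fun p v hp => ?_) n hn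
  rw [sum_tupleDivisors_tuplePow hp]
  have h1 : ∀ e ∈ Fintype.piFinset (fun i => range (v i + 1)),
      coprimeCoeff t (tuplePow p e) *
        ∏ i, ((ζ : ArithmeticFunction ℝ) ^ t i) ((tuplePow p v / tuplePow p e) i) =
      (1 - (#{i | e i ≠ 0} : ℝ)) * ∏ i, (fun i k => ((μ : ArithmeticFunction ℝ) ^ t i) (p ^ k) *
        ((ζ : ArithmeticFunction ℝ) ^ t i) (p ^ (v i - k))) i (e i) := fun e he => by
    rw [coprimeCoeff, coprimalityKernel_tuplePow hp, mul_assoc, ← Finset.prod_mul_distrib]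
    congr 1
    refine Finset.prod_congr rfl fun i _ => ?_
    have := Fintype.mem_piFinset.1 he i
    simp only [Finset.mem_range] at this
    simp only [tuplePow, Pi.div_apply]
    rw [Nat.pow_div (by omega) hp.pos]
  rw [Finset.sum_congr rfl h1, sum_one_sub_card_mul_prod v (fun i k =>
    ((μ : ArithmeticFunction ℝ) ^ t i) (p ^ k) * ((ζ : ArithmeticFunction ℝ) ^ t i) (p ^ (v i - k)))]
  simp only [sum_moebius_pow_mul_zeta_pow _ hp]
  have hz1 : ∀ i, ((ζ : ArithmeticFunction ℝ) ^ t i) 1 = 1 := fun i =>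
    (ArithmeticFunction.isMultiplicative_zeta.natCast.pow).map_one
  have hm1 : ∀ i, ((μ : ArithmeticFunction ℝ) ^ t i) 1 = 1 := fun i =>
    (ArithmeticFunction.isMultiplicative_moebius.intCast.pow).map_one
  simp only [pow_zero, hm1, one_mul, tsub_zero]
  by_cases h0 : ∀ i, v i = 0
  · have : tuplePow p v = 1 := by ext i; simp [tuplePow, h0 i]
    rw [this, tupleMultiplicative_pairwiseCoprimeIndicator.map_one]
    simp [h0, hz1]
  · push Not at h0
    obtain ⟨j, hj⟩ := h0
    rw [Finset.prod_eq_zero (Finset.mem_univ j) (by simp [hj])]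
    by_cases h2 : ∃ k, k ≠ j ∧ v k ≠ 0
    · obtain ⟨k, hkj, hk⟩ := h2
      have hnc : pairwiseCoprimeIndicator (tuplePow p v) = 0 := by
        rw [pairwiseCoprimeIndicator, if_neg]
        intro H
        exact Nat.not_coprime_of_dvd_of_dvd hp.one_lt (dvd_pow_self p hk) (dvd_pow_self p hj)
          (H k j hkj)
      rw [hnc, zero_mul, Finset.sum_eq_zero, sub_zero]
      intro l _
      by_cases hl : l = j
      · rw [Finset.prod_eq_zero (i := k) (by simp [hl, hkj]) (by simp [hk]), mul_zero]
      · rw [Finset.prod_eq_zero (i := j) (by simp [Ne.symm hl]) (by simp [hj]), mul_zero]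
    · push Not at h2
      have hc : pairwiseCoprimeIndicator (tuplePow p v) = 1 := by
        rw [pairwiseCoprimeIndicator, if_pos]
        intro a b hab
        by_cases ha : a = j
        · have : v b = 0 := h2 b (by rintro rfl; exact hab ha)
          simp [tuplePow, this]
        · simp [tuplePow, h2 a ha]
      rw [hc, one_mul, Finset.sum_eq_single j, ← Finset.mul_prod_erase _ _ (Finset.mem_univ j)]
      · rw [Finset.prod_eq_one (s := univ.erase j)
          (f := fun i => if v i = 0 then (1 : ℝ) else 0)
          (fun i hi => by simp [h2 i (Finset.ne_of_mem_erase hi)]),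
          Finset.prod_eq_one (s := univ.erase j)
          (fun i hi => by simp [tuplePow, h2 i (Finset.ne_of_mem_erase hi), hz1])]
        simp [hj, tuplePow]
      · intro l _ hl
        simp [h2 l hl, hz1]
      · simp

end Tuple

/-! ### The coprime sum as a weighted series of products of summatory functions. -/

/-- The summatory function of `τ_t`. -/
noncomputable def piltzSum (t : ℕ) (y : ℝ) : ℝ := ∑ n ∈ Finset.Icc 1 ⌊y⌋₊, (piltzTau t n : ℝ)

lemma piltzSum_eq_zero (t : ℕ) {y : ℝ} (hy : y < 1) : piltzSum t y = 0 := by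
  simp [piltzSum, Nat.floor_eq_zero.2 hy]

lemma sum_filter_dvd_div (φ : ℕ → ℝ) (X : ℕ) {d : ℕ} (hd : d ≠ 0) :
    ∑ n ∈ (Icc 1 X).filter (d ∣ ·), φ (n / d) = ∑ m ∈ Icc 1 (X / d), φ m := by
  symm
  have hd' : 0 < d := Nat.pos_of_ne_zero hd
  refine Finset.sum_nbij' (fun m => d * m) (fun n => n / d) ?_ ?_ ?_ ?_ ?_
  · intro m hm
    simp only [Finset.mem_Icc, Nat.le_div_iff_mul_le hd'] at hm
    simp only [Finset.mem_filter, Finset.mem_Icc, dvd_mul_right, and_true]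
    exact ⟨Nat.mul_pos hd' hm.1, by linarith [mul_comm d m]⟩
  · intro n hn
    simp only [Finset.mem_filter, Finset.mem_Icc] at hn
    rw [Finset.mem_Icc]
    exact ⟨Nat.div_pos (Nat.le_of_dvd (by omega) hn.2) hd', Nat.div_le_div_right hn.1.2⟩
  · intro m _
    exact Nat.mul_div_cancel_left m hd'
  · intro n hn
    exact Nat.mul_div_cancel' (Finset.mem_filter.1 hn).2
  · intro m _
    simp only [Nat.mul_div_cancel_left m hd']

lemma pairwiseCoprimeTauSum_eq_tsum {r : ℕ} (t : Fin r → ℕ) (x : ℝ) :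
    pairwiseCoprimeTauSum t x =
      ∑' d : Fin r → ℕ, coprimeCoeff t d * ∏ i, piltzSum (t i) (x / d i) := by
  rw [tsum_eq_sum (s := Fintype.piFinset fun _ : Fin r => Finset.Icc 1 ⌊x⌋₊)]
  · have h1 : ∀ n ∈ Fintype.piFinset (fun _ : Fin r => Finset.Icc 1 ⌊x⌋₊),
        (if ∀ i j, i ≠ j → Nat.Coprime (n i) (n j) then ∏ i, (piltzTau (t i) (n i) : ℝ) else 0) =
        ∑ d ∈ tupleDivisors n, coprimeCoeff t d * ∏ i, (piltzTau (t i) ((n / d) i) : ℝ) := by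
      intro n hn
      have hn0 : ∀ i, n i ≠ 0 := fun i => by
        have := Fintype.mem_piFinset.1 hn i
        rw [Finset.mem_Icc] at this
        omega
      simp only [piltzTau_eq_zeta_pow]
      rw [convolution_coprimeCoeff t n hn0, pairwiseCoprimeIndicator, ite_mul, one_mul, zero_mul]
      congr
    rw [pairwiseCoprimeTauSum, Finset.sum_filter, Finset.sum_congr rfl h1,
      Finset.sum_comm' (t' := Fintype.piFinset fun _ : Fin r => Finset.Icc 1 ⌊x⌋₊)
      (s' := fun d => Fintype.piFinset fun i => (Icc 1 ⌊x⌋₊).filter (d i ∣ ·))]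
    · refine Finset.sum_congr rfl fun d hd => ?_
      rw [← Finset.mul_sum]
      congr 1
      simp only [Pi.div_apply]
      rw [← Finset.prod_univ_sum (fun i => (Icc 1 ⌊x⌋₊).filter (d i ∣ ·))
        (fun i k => (piltzTau (t i) (k / d i) : ℝ))]
      refine Finset.prod_congr rfl fun i _ => ?_
      have hd0 : d i ≠ 0 := by
        have := Fintype.mem_piFinset.1 hd i
        rw [Finset.mem_Icc] at this
        omega
      rw [sum_filter_dvd_div (fun m => (piltzTau (t i) m : ℝ)) _ hd0, piltzSum,
        Nat.floor_div_natCast]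
    · intro n d
      simp only [Fintype.mem_piFinset, mem_tupleDivisors, Finset.mem_filter, Finset.mem_Icc]
      constructor
      · rintro ⟨h1, h2⟩
        refine ⟨fun i => ⟨h1 i, (h2 i).1⟩, fun i => ⟨?_, ?_⟩⟩
        · exact Nat.pos_of_ne_zero (ne_zero_of_dvd_ne_zero (h2 i).2 (h2 i).1)
        · exact (Nat.le_of_dvd (h1 i).1 (h2 i).1).trans (h1 i).2
      · rintro ⟨h1, h2⟩
        exact ⟨fun i => (h1 i).1, fun i => ⟨(h1 i).2, by have := (h1 i).1; omega⟩⟩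
  -- The series is finite: outside the box some `d i` is `0`, where the coefficient vanishes, or
  -- exceeds `x`, where the summatory function is empty.
  · intro d hd
    simp only [Fintype.mem_piFinset, Finset.mem_Icc, not_forall, not_and, not_le] at hd
    obtain ⟨i, hi⟩ := hd
    by_cases h0 : d i = 0
    · rw [coprimeCoeff_eq_zero t h0, zero_mul]
    · rw [Finset.prod_eq_zero (Finset.mem_univ i), mul_zero]
      have h2 := hi (Nat.pos_of_ne_zero h0)
      refine piltzSum_eq_zero _ ?_
      rw [div_lt_one (by positivity)]
      exact (Nat.floor_lt' h0).1 h2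

/-! ### Euler products over tuples -/

section EulerProduct

variable {ι : Type*} [Fintype ι]

/-- The weighted coefficients `g(d) ∏ d_i ^ (-s_i)`. -/
noncomputable def coprimeTerm (t : ι → ℕ) (s : ι → ℝ) (d : ι → ℕ) : ℝ :=
  coprimeCoeff t d * ∏ i, (d i : ℝ) ^ (-s i)

lemma tupleMultiplicative_coprimeTerm (t : ι → ℕ) (s : ι → ℝ) :
    TupleMultiplicative (coprimeTerm t s) :=
  (tupleMultiplicative_coprimeCoeff t).mul (tupleMultiplicative_prod_rpow fun i => -s i)

variable [DecidableEq ι]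

/-- The divisors of the tuple `(∏_{p ∈ S} p ^ t i)_i`. -/
def smoothTuples (t : ι → ℕ) (S : Finset Nat.Primes) : Finset (ι → ℕ) :=
  tupleDivisors (∏ p ∈ S.map ⟨fun p : Nat.Primes => (p : ℕ), Subtype.coe_injective⟩, tuplePow p t)

/-- The binomials `(t i).choose (e i)` vanish for `e i > t i`, so the support only contains tuples
whose exponents are bounded by `t`. Finite partial Euler products are therefore exactly finite sums
over divisors. -/
lemma eventually_mem_smoothTuples (t : ι → ℕ) {d : ι → ℕ} (hd : coprimeCoeff t d ≠ 0) :
    ∀ᶠ S : Finset Nat.Primes in atTop, d ∈ smoothTuples t S := by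
  have hd0 : ∀ i, d i ≠ 0 := fun i h => hd (coprimeCoeff_eq_zero t h)
  have hle : ∀ p ∈ (∏ i, d i).primeFactors, ∀ i, (d i).factorization p ≤ t i := by
    intro p hp i
    have hprod := hd
    rw [eq_prod_tuplePow d hd0, (tupleMultiplicative_coprimeCoeff t).map_prod _
      (fun p hp => Nat.prime_of_mem_primeFactors hp), Finset.prod_ne_zero_iff] at hprod
    have h1 := hprod p hp
    rw [coprimeCoeff_tuplePow t (Nat.prime_of_mem_primeFactors hp)] at h1
    have h2 := Finset.prod_ne_zero_iff.1 (right_ne_zero_of_mul h1) i (Finset.mem_univ i)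
    have h3 := right_ne_zero_of_mul h2
    by_contra hlt
    exact h3 (by rw [Nat.choose_eq_zero_of_lt (not_le.1 hlt), Nat.cast_zero])
  filter_upwards [eventually_ge_atTop ((∏ i, d i).primeFactors.subtype Nat.Prime)] with S hS
  rw [smoothTuples, mem_tupleDivisors]
  intro i
  rw [prod_tuplePow_apply]
  constructor
  · have h1 := congrFun (eq_prod_tuplePow d hd0) i
    rw [prod_tuplePow_apply] at h1
    rw [h1]
    refine (Finset.prod_dvd_prod_of_dvd _ (fun p => p ^ t i)
      fun p hp => pow_dvd_pow p (hle p hp i)).trans (Finset.prod_dvd_prod_of_subset _ _ _ ?_)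
    intro p hp
    have hp' := Nat.prime_of_mem_primeFactors hp
    have h2 : (⟨p, hp'⟩ : Nat.Primes) ∈ S := hS (by simpa using hp)
    exact Finset.mem_map.2 ⟨_, h2, rfl⟩
  · refine Finset.prod_ne_zero_iff.2 fun p hp => pow_ne_zero _ ?_
    obtain ⟨q, _, rfl⟩ := Finset.mem_map.1 hp
    exact q.2.ne_zero

/-- The local factor at `p` of the Euler product of `F`, truncated at the exponents `t i`. -/
noncomputable def localFactor (t : ι → ℕ) (F : (ι → ℕ) → ℝ) (p : ℕ) : ℝ :=
  ∑ e ∈ Fintype.piFinset (fun i => range (t i + 1)), F (tuplePow p e)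

lemma TupleMultiplicative.sum_smoothTuples {F : (ι → ℕ) → ℝ} (hF : TupleMultiplicative F)
    (t : ι → ℕ) (S : Finset Nat.Primes) :
    ∑ d ∈ smoothTuples t S, F d = ∏ p ∈ S, localFactor t F p := by
  -- A divisor sum is a convolution with the constant `1`, hence multiplicative in the tuple whose
  -- divisors are taken.
  have hone : TupleMultiplicative (fun _ : ι → ℕ => (1 : ℝ)) := ⟨rfl, by simp⟩
  have h := (hF.convolution hone).map_prod
    (S.map ⟨fun p : Nat.Primes => (p : ℕ), Subtype.coe_injective⟩)
    (fun p hp => by obtain ⟨q, _, rfl⟩ := Finset.mem_map.1 hp; exact q.2) (fun _ => t)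
  simp only [mul_one, Finset.prod_map] at h
  rw [smoothTuples, Finset.prod_map]
  refine h.trans (Finset.prod_congr rfl fun p _ => ?_)
  exact sum_tupleDivisors_tuplePow p.2 t F

lemma TupleMultiplicative.summable {F : (ι → ℕ) → ℝ} (hF : TupleMultiplicative F) (t : ι → ℕ)
    (hsupp : ∀ d, F d ≠ 0 → coprimeCoeff t d ≠ 0) (hnonneg : ∀ d, 0 ≤ F d) {a : Nat.Primes → ℝ}
    (ha : Summable a) (ha0 : ∀ p, 0 ≤ a p) (hle : ∀ p : Nat.Primes, localFactor t F p ≤ 1 + a p) :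
    Summable F := by
  refine summable_of_sum_le (c := Real.exp (∑' p, a p)) hnonneg fun u => ?_
  have hev : ∀ᶠ S : Finset Nat.Primes in atTop, ∀ d ∈ u, F d ≠ 0 → d ∈ smoothTuples t S := by
    rw [Filter.eventually_all_finset]
    intro d _
    by_cases h : F d = 0
    · simp [h]
    · filter_upwards [eventually_mem_smoothTuples t (hsupp d h)] with S hS _ using hS
  obtain ⟨S, hS⟩ := hev.exists
  calc ∑ d ∈ u, F d ≤ ∑ d ∈ smoothTuples t S, F d := by
        rw [← Finset.sum_filter_ne_zero]
        refine Finset.sum_le_sum_of_subset_of_nonneg (fun d hd => ?_) fun d _ _ => hnonneg d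
        rw [Finset.mem_filter] at hd
        exact hS d hd.1 hd.2
    _ = ∏ p ∈ S, localFactor t F p := hF.sum_smoothTuples t S
    _ ≤ ∏ p ∈ S, Real.exp (a p) := by
        refine Finset.prod_le_prod (fun p _ => Finset.sum_nonneg fun e _ => hnonneg _) fun p _ => ?_
        linarith [hle p, Real.add_one_le_exp (a p)]
    _ = Real.exp (∑ p ∈ S, a p) := (Real.exp_sum _ _).symm
    _ ≤ Real.exp (∑' p, a p) := Real.exp_le_exp.2 (ha.sum_le_tsum _ fun p _ => ha0 p)

/-- Partial products are sums of `F` over sets that eventually contain each point of the support, so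
dominated convergence applies, with dominating function `‖F‖`. -/
lemma TupleMultiplicative.hasProd {F : (ι → ℕ) → ℝ} (hF : TupleMultiplicative F) (t : ι → ℕ)
    (hsupp : ∀ d, F d ≠ 0 → coprimeCoeff t d ≠ 0) (hsum : Summable F) :
    HasProd (fun p : Nat.Primes => localFactor t F p) (∑' d, F d) := by
  have h : Tendsto (fun S : Finset Nat.Primes =>
      ∑' d, (smoothTuples t S : Set (ι → ℕ)).indicator F d) atTop (𝓝 (∑' d, F d)) := by
    refine tendsto_tsum_of_dominated_convergence hsum.norm (fun d => ?_) (Eventually.of_forall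
      fun S d => norm_indicator_le_norm_self _ _)
    by_cases hd : F d = 0
    · have : ∀ S : Finset Nat.Primes, (smoothTuples t S : Set (ι → ℕ)).indicator F d = F d :=
        fun S => by rw [Set.indicator_apply]; simp [hd]
      simp only [this]
      exact tendsto_const_nhds
    · refine tendsto_const_nhds.congr' ?_
      filter_upwards [eventually_mem_smoothTuples t (hsupp d hd)] with S hS
      rw [Set.indicator_of_mem (Finset.mem_coe.2 hS)]
  rw [HasProd, SummationFilter.unconditional_filter]
  refine h.congr fun S => ?_
  rw [← hF.sum_smoothTuples, ← Finset.tsum_subtype]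
  exact (_root_.tsum_subtype (smoothTuples t S : Set (ι → ℕ)) F).symm

/-- One nonzero exponent gives coefficient zero; with two or more, at positions `i ≠ j` among
others, the power of `p` is at most `p ^ (-(s i + s j))`. This is the source of all convergence
below. -/
lemma abs_coprimeTerm_tuplePow_le (t : ι → ℕ) {s : ι → ℝ} (hs : ∀ i, 0 ≤ s i) {σ : ℝ}
    (hσ : ∀ i j, i ≠ j → σ ≤ s i + s j) {p : ℕ} (hp : p.Prime) (e : ι → ℕ) :
    |coprimeTerm t s (tuplePow p e)| ≤ (if e = 0 then 1 else 0) +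
      |1 - (#{i | e i ≠ 0} : ℝ)| * (∏ i, ((t i).choose (e i) : ℝ)) * (p : ℝ) ^ (-σ) := by
  have hp1 : (1 : ℝ) ≤ p := by exact_mod_cast hp.one_le
  have hnn : 0 ≤ |1 - (#{i | e i ≠ 0} : ℝ)| * (∏ i, ((t i).choose (e i) : ℝ)) * (p : ℝ) ^ (-σ) := by
    positivity
  by_cases h0 : e = 0
  · have : tuplePow p e = 1 := by ext i; simp [tuplePow, h0]
    rw [this, (tupleMultiplicative_coprimeTerm t s).map_one, if_pos h0]
    simpa using hnn
  rw [if_neg h0, zero_add, coprimeTerm, coprimeCoeff_tuplePow t hp, abs_mul, abs_mul,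
    Finset.abs_prod]
  simp only [abs_mul, abs_pow, abs_neg, abs_one, one_pow, one_mul, Nat.abs_cast]
  by_cases h1 : #{i | e i ≠ 0} = 1
  · simp [h1]
  refine mul_le_mul_of_nonneg_left ?_ (by positivity)
  have hprod : ∏ i, (tuplePow p e i : ℝ) ^ (-s i) = (p : ℝ) ^ (-∑ i, e i * s i) := by
    rw [← Finset.sum_neg_distrib, Real.rpow_sum_of_pos (by linarith)]
    refine Finset.prod_congr rfl fun i _ => ?_
    rw [tuplePow, Nat.cast_pow, ← Real.rpow_natCast, ← Real.rpow_mul (by linarith)]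
    congr 1
    ring
  rw [hprod, abs_of_nonneg (by positivity)]
  refine Real.rpow_le_rpow_of_exponent_le hp1 (neg_le_neg ?_)
  have h2 : 1 < #{i | e i ≠ 0} := by
    have : 0 < #{i | e i ≠ 0} := by
      rw [Finset.card_pos]
      by_contra hne
      rw [Finset.not_nonempty_iff_eq_empty, Finset.filter_eq_empty_iff] at hne
      exact h0 (funext fun i => by simpa using hne (Finset.mem_univ i))
    omega
  obtain ⟨i, hi, j, hj, hij⟩ := Finset.one_lt_card.1 h2
  simp only [Finset.mem_filter, Finset.mem_univ, true_and] at hi hj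
  have hterm : ∀ k, e k ≠ 0 → s k ≤ e k * s k := fun k hk => by
    have : (1 : ℝ) ≤ e k := by exact_mod_cast Nat.one_le_iff_ne_zero.2 hk
    nlinarith [hs k]
  calc σ ≤ s i + s j := hσ i j hij
    _ ≤ e i * s i + e j * s j := add_le_add (hterm i hi) (hterm j hj)
    _ = ∑ k ∈ ({i, j} : Finset ι), e k * s k := (Finset.sum_pair (f := fun k => (e k : ℝ) * s k) hij).symm
    _ ≤ ∑ k, e k * s k := Finset.sum_le_sum_of_subset_of_nonneg (Finset.subset_univ _)
        fun k _ _ => mul_nonneg (Nat.cast_nonneg _) (hs k)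

lemma exists_localFactor_abs_coprimeTerm_le (t : ι → ℕ) :
    ∃ C : ℝ, 0 ≤ C ∧ ∀ (s : ι → ℝ) (σ : ℝ), (∀ i, 0 ≤ s i) → (∀ i j, i ≠ j → σ ≤ s i + s j) →
      ∀ p : ℕ, p.Prime →
        localFactor t (fun d => |coprimeTerm t s d|) p ≤ 1 + C * (p : ℝ) ^ (-σ) := by
  refine ⟨∑ e ∈ Fintype.piFinset (fun i => range (t i + 1)),
    |1 - (#{i | e i ≠ 0} : ℝ)| * (∏ i, ((t i).choose (e i) : ℝ)),
    Finset.sum_nonneg fun e _ => by positivity, fun s σ hs hσ p hp => ?_⟩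
  refine (Finset.sum_le_sum fun e _ => abs_coprimeTerm_tuplePow_le t hs hσ hp e).trans ?_
  rw [Finset.sum_add_distrib, Finset.sum_mul]
  refine add_le_add_left ?_ _
  rw [Finset.sum_ite_eq']
  split_ifs <;> norm_num

lemma summable_coprimeTerm (t : ι → ℕ) {s : ι → ℝ} (hs : ∀ i, 0 ≤ s i) {σ : ℝ} (hσ1 : 1 < σ)
    (hσ : ∀ i j, i ≠ j → σ ≤ s i + s j) : Summable (fun d => |coprimeTerm t s d|) := by
  obtain ⟨C, hC, h⟩ := exists_localFactor_abs_coprimeTerm_le t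
  refine (tupleMultiplicative_coprimeTerm t s).abs.summable t
    (a := fun p => C * ((p : ℕ) : ℝ) ^ (-σ)) (fun d hd h0 => hd ?_) (fun d => abs_nonneg _)
    (Summable.mul_left _ (Nat.Primes.summable_rpow.2 (by linarith))) (fun p => by positivity)
    (fun p => h s σ hs hσ p p.2)
  rw [coprimeTerm, h0, zero_mul, abs_zero]

end EulerProduct

/-! ### The Euler product `deltaBar` -/

lemma sum_powerset_one_sub_card_mul_prod {ι : Type*} [Fintype ι] [DecidableEq ι] (y : ι → ℝ) :
    ∑ L ∈ (univ : Finset ι).powerset, (1 - (#L : ℝ)) * ∏ l ∈ L, y l =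
      ∏ i, (1 + y i) - ∑ j, y j * ∏ i ∈ univ.erase j, (1 + y i) := by
  have h2 : ∀ j, y j * ∏ i ∈ univ.erase j, (1 + y i) =
      ∑ L ∈ (univ : Finset ι).powerset, (if j ∈ L then ∏ l ∈ L, y l else 0) := fun j => by
    -- Giving the `j`-th factor no constant term makes the expansion select exactly the subsets
    -- containing `j`.
    have h := Finset.prod_add y (fun i => if i = j then 0 else 1) univ
    rw [← Finset.mul_prod_erase _ _ (Finset.mem_univ j)] at h
    rw [if_pos rfl, add_zero, Finset.prod_congr rfl (g := fun i => 1 + y i) (fun i hi => by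
      rw [if_neg (Finset.ne_of_mem_erase hi), add_comm])] at h
    rw [h]
    refine Finset.sum_congr rfl fun L _ => ?_
    by_cases hj : j ∈ L
    · rw [if_pos hj, Finset.prod_eq_one (s := univ \ L), mul_one]
      intro i hi
      rw [if_neg]
      rintro rfl
      exact (Finset.mem_sdiff.1 hi).2 hj
    · rw [if_neg hj, Finset.prod_eq_zero (s := univ \ L) (i := j) (by simp [hj]) (by simp),
        mul_zero]
  simp only [h2]
  rw [Finset.prod_one_add, Finset.sum_comm, ← Finset.sum_sub_distrib]
  refine Finset.sum_congr rfl fun L _ => ?_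
  rw [← Finset.sum_filter, Finset.filter_mem_eq_inter, Finset.univ_inter, Finset.sum_const,
    nsmul_eq_mul]
  ring

lemma sum_range_alternating_choose (n p : ℕ) :
    ∑ k ∈ range (n + 1), (-1 : ℝ) ^ k * (n.choose k : ℝ) * ((p : ℝ) ^ k)⁻¹ =
      (1 - (p : ℝ)⁻¹) ^ n := by
  rw [sub_eq_add_neg, add_comm (1 : ℝ), add_pow]
  refine Finset.sum_congr rfl fun k _ => ?_
  rw [neg_pow (p : ℝ)⁻¹, inv_pow, one_pow (n - k)]
  ring

lemma localFactor_coprimeTerm_one {ι : Type*} [Fintype ι] [DecidableEq ι] (t : ι → ℕ) {p : ℕ}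
    (hp : p.Prime) :
    localFactor t (coprimeTerm t fun _ => 1) p =
      ∏ i, (1 - (p : ℝ)⁻¹) ^ t i -
        ∑ j, ((1 - (p : ℝ)⁻¹) ^ t j - 1) * ∏ i ∈ univ.erase j, (1 - (p : ℝ)⁻¹) ^ t i := by
  have h : ∀ e : ι → ℕ, coprimeTerm t (fun _ => 1) (tuplePow p e) =
      (1 - (#{i | e i ≠ 0} : ℝ)) *
        ∏ i, ((-1) ^ e i * ((t i).choose (e i) : ℝ) * ((p : ℝ) ^ e i)⁻¹) := fun e => by
    rw [coprimeTerm, coprimeCoeff_tuplePow t hp, mul_assoc, ← Finset.prod_mul_distrib]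
    simp [tuplePow, Real.rpow_neg_one]
  simp only [localFactor, h]
  rw [sum_one_sub_card_mul_prod t
    (fun i k => (-1) ^ k * ((t i).choose k : ℝ) * ((p : ℝ) ^ k)⁻¹)]
  simp [sum_range_alternating_choose]

/-- The sum over `a` factors into `y_l = (1 - 1/p)^{t_l} - 1`, so the factor is `∑_L (1 - #L) ∏_{l ∈
L} y_l`, grouped by `i = #L`. -/
lemma deltaBarFactor_eq {r : ℕ} (t : Fin r → ℕ) (p : ℕ) :
    deltaBarFactor t p =
      ∏ i, (1 - (p : ℝ)⁻¹) ^ t i -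
        ∑ j, ((1 - (p : ℝ)⁻¹) ^ t j - 1) * ∏ i ∈ univ.erase j, (1 - (p : ℝ)⁻¹) ^ t i := by
  have hy : ∀ l, ∑ a ∈ Icc 1 (t l), 1 / (p : ℝ) ^ a * ((-1 : ℝ) ^ a * ((t l).choose a : ℝ)) =
      (1 - (p : ℝ)⁻¹) ^ t l - 1 := fun l => by
    rw [← sum_range_alternating_choose, Finset.range_eq_Ico, Finset.sum_eq_sum_Ico_succ_bot
      (by omega)]
    simp only [zero_add, pow_zero, Nat.choose_zero_right, Nat.cast_one, mul_one, inv_one,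
      add_sub_cancel_left]
    refine Finset.sum_congr (by ext; simp) fun a _ => ?_
    rw [one_div]
    ring
  have hL : ∀ L : Finset (Fin r), ∑ a ∈ Fintype.piFinset (fun l : L => Finset.Icc 1 (t l)),
      1 / (p : ℝ) ^ (∑ l, a l) * ∏ l : L, (-1 : ℝ) ^ a l * ((t l).choose (a l) : ℝ) =
      ∏ l ∈ L, ((1 - (p : ℝ)⁻¹) ^ t l - 1) := fun L => by
    rw [← Finset.prod_coe_sort]
    simp only [← hy]
    rw [Finset.prod_univ_sum]
    refine Finset.sum_congr rfl fun a _ => ?_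
    conv_rhs => rw [Finset.prod_mul_distrib, Finset.prod_div_distrib, Finset.prod_const_one,
      Finset.prod_pow_eq_pow_sum]
  simp only [deltaBarFactor, hL]
  have h := sum_powerset_one_sub_card_mul_prod (fun l => (1 - (p : ℝ)⁻¹) ^ t l - 1)
  simp only [add_sub_cancel] at h
  rw [← h, Finset.sum_powerset, Finset.card_univ, Fintype.card_fin]
  have h1 : ∀ i ∈ range (r + 1), ∑ L ∈ powersetCard i (univ : Finset (Fin r)),
      (1 - (#L : ℝ)) * ∏ l ∈ L, ((1 - (p : ℝ)⁻¹) ^ t l - 1) =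
      (1 - (i : ℝ)) * ∑ L ∈ powersetCard i (univ : Finset (Fin r)),
        ∏ l ∈ L, ((1 - (p : ℝ)⁻¹) ^ t l - 1) := fun i _ => by
    rw [Finset.mul_sum]
    refine Finset.sum_congr rfl fun L hL => ?_
    rw [(Finset.mem_powersetCard.1 hL).2]
  rw [Finset.sum_congr rfl h1, Finset.range_eq_Ico, Finset.sum_eq_sum_Ico_succ_bot (by omega)]
  rw [sub_eq_add_neg, ← Finset.sum_neg_distrib]
  congr 1
  · simp
  -- The definition starts at `i = 2`; the extra term `i = 1` has weight `1 - i = 0`.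
  · refine Finset.sum_subset_zero_on_sdiff (fun i hi => ?_) (fun i hi => ?_) (fun i hi => ?_)
    · simp at hi ⊢; omega
    · have : i = 1 := by simp at hi; omega
      simp [this]
    · ring

lemma deltaBarFactor_eq_localFactor {r : ℕ} (t : Fin r → ℕ) {p : ℕ} (hp : p.Prime) :
    deltaBarFactor t p = localFactor t (coprimeTerm t fun _ => 1) p := by
  rw [deltaBarFactor_eq, localFactor_coprimeTerm_one t hp]

lemma deltaBarFactor_pos {r : ℕ} (t : Fin r → ℕ) {p : ℕ} (hp : p.Prime) :
    0 < deltaBarFactor t p := by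
  have hp1 : (1 : ℝ) < p := by exact_mod_cast hp.one_lt
  have h0 : 0 < 1 - (p : ℝ)⁻¹ := sub_pos.2 (inv_lt_one_of_one_lt₀ hp1)
  have h1 : 1 - (p : ℝ)⁻¹ ≤ 1 := by
    have : 0 ≤ (p : ℝ)⁻¹ := by positivity
    linarith
  rw [deltaBarFactor_eq, sub_eq_add_neg, ← Finset.sum_neg_distrib]
  refine add_pos_of_pos_of_nonneg (Finset.prod_pos fun i _ => pow_pos h0 _)
    (Finset.sum_nonneg fun j _ => ?_)
  rw [← neg_mul, neg_sub]
  exact mul_nonneg (sub_nonneg.2 (pow_le_one₀ h0.le h1))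
    (Finset.prod_nonneg fun i _ => (pow_pos h0 _).le)

lemma hasProd_deltaBarFactor {r : ℕ} (t : Fin r → ℕ) :
    HasProd (fun p : Nat.Primes => deltaBarFactor t (p : ℕ))
      (∑' d, coprimeTerm t (fun _ => 1) d) := by
  have h : Summable (coprimeTerm t fun _ => 1) :=
    (summable_coprimeTerm t (fun _ => zero_le_one) (σ := 2) (by norm_num)
      (fun _ _ _ => by norm_num)).of_abs
  simp only [fun p : Nat.Primes => deltaBarFactor_eq_localFactor t p.2]
  exact (tupleMultiplicative_coprimeTerm t _).hasProd t
    (fun d hd h0 => hd (by rw [coprimeTerm, h0, zero_mul])) h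

lemma deltaBar_eq_tsum {r : ℕ} (t : Fin r → ℕ) :
    deltaBar t = ∑' d, coprimeTerm t (fun _ => 1) d :=
  (hasProd_deltaBarFactor t).tprod_eq

lemma exists_abs_deltaBarFactor_sub_one_le {r : ℕ} (t : Fin r → ℕ) :
    ∃ C : ℝ, ∀ p : ℕ, p.Prime → |deltaBarFactor t p - 1| ≤ C * (p : ℝ) ^ (-2 : ℝ) := by
  obtain ⟨C, -, h⟩ := exists_localFactor_abs_coprimeTerm_le t
  refine ⟨C, fun p hp => ?_⟩
  have h1 := h (fun _ => 1) 2 (fun _ => zero_le_one) (fun _ _ _ => by norm_num) p hp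
  have hmem : (0 : Fin r → ℕ) ∈ Fintype.piFinset (fun i => range (t i + 1)) := by simp
  have hone : tuplePow p (0 : Fin r → ℕ) = 1 := by ext i; simp [tuplePow]
  rw [deltaBarFactor_eq_localFactor t hp]
  simp only [localFactor] at h1 ⊢
  rw [← Finset.add_sum_erase _ _ hmem, hone, (tupleMultiplicative_coprimeTerm t _).map_one] at h1 ⊢
  rw [abs_one] at h1
  rw [add_sub_cancel_left]
  exact (Finset.abs_sum_le_sum_abs _ _).trans (by linarith)

/-- Positive factors alone do not suffice. As they are `1 + O(p ^ (-2))`, their logarithms are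
summable and the product is an exponential. -/
lemma deltaBar_pos {r : ℕ} (t : Fin r → ℕ) : 0 < deltaBar t := by
  obtain ⟨C, hC⟩ := exists_abs_deltaBarFactor_sub_one_le t
  have hs : Summable fun p : Nat.Primes => deltaBarFactor t (p : ℕ) - 1 :=
    Summable.of_norm_bounded ((Nat.Primes.summable_rpow.2 (by norm_num : (-2 : ℝ) < -1)).mul_left C)
      fun p => hC p p.2
  have hl := Real.summable_log_one_add_of_summable hs
  simp only [add_sub_cancel] at hl
  rw [deltaBar, ← Real.rexp_tsum_eq_tprod (fun p => deltaBarFactor_pos t p.2) hl]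
  exact Real.exp_pos _

/-! ### The summatory function of the Piltz divisor function -/

lemma lseriesSummable_zeta_pow (t : ℕ) {s : ℂ} (hs : 1 < s.re) :
    LSeriesSummable (fun n => ((ζ : ArithmeticFunction ℂ) ^ t) n) s := by
  induction t with
  | zero =>
    refine (hasSum_single 1 fun n hn => ?_).summable
    simp [LSeries.term_def, ArithmeticFunction.one_apply_ne hn]
  | succ t ih =>
    rw [pow_succ]
    exact ArithmeticFunction.LSeriesSummable_mul ih
      (ArithmeticFunction.LSeriesSummable_zeta_iff.2 hs)

lemma summable_piltzTau_mul_rpow (t : ℕ) {σ : ℝ} (hσ : 1 < σ) :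
    Summable fun n : ℕ => (piltzTau t n : ℝ) * (n : ℝ) ^ (-σ) := by
  have h := (lseriesSummable_zeta_pow t (s := (σ : ℂ)) (by simpa using hσ)).norm
  refine h.congr fun n => ?_
  rw [LSeries.norm_term_eq, ← piltzTau_eq_zeta_pow, Complex.norm_natCast, Complex.ofReal_re]
  split_ifs with h0
  · rw [h0]; simp [piltzTau]
  · rw [Real.rpow_neg (Nat.cast_nonneg _), div_eq_mul_inv]

lemma piltzSum_nonneg (t : ℕ) (y : ℝ) : 0 ≤ piltzSum t y :=
  Finset.sum_nonneg fun _ _ => Nat.cast_nonneg _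

/-- Rankin's trick: `1 ≤ (y / n) ^ σ` for `n ≤ y`, and the Dirichlet series of `τ_t` converges at
`σ`. -/
lemma exists_piltzSum_le (t : ℕ) {σ : ℝ} (hσ : 1 < σ) :
    ∃ C : ℝ, 0 ≤ C ∧ ∀ y : ℝ, 0 ≤ y → piltzSum t y ≤ C * y ^ σ := by
  have hs := summable_piltzTau_mul_rpow t hσ
  have hnn : ∀ n : ℕ, 0 ≤ (piltzTau t n : ℝ) * (n : ℝ) ^ (-σ) := fun n => by positivity
  refine ⟨∑' n : ℕ, (piltzTau t n : ℝ) * (n : ℝ) ^ (-σ), tsum_nonneg hnn, fun y hy => ?_⟩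
  refine le_trans ?_ (mul_le_mul_of_nonneg_right
    (hs.sum_le_tsum (Finset.Icc 1 ⌊y⌋₊) fun n _ => hnn n) (Real.rpow_nonneg hy σ))
  rw [piltzSum, Finset.sum_mul]
  refine Finset.sum_le_sum fun n hn => ?_
  rw [Finset.mem_Icc] at hn
  have hn0 : (0 : ℝ) < n := by exact_mod_cast hn.1
  have hny : (n : ℝ) ≤ y := (Nat.le_floor_iff hy).1 hn.2
  rw [mul_assoc, Real.rpow_neg hn0.le, ← div_eq_inv_mul, ← Real.div_rpow hy hn0.le]
  exact le_mul_of_one_le_right (Nat.cast_nonneg _)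
    (Real.one_le_rpow ((one_le_div hn0).2 hny) (by linarith))

lemma Polynomial.exists_abs_eval_le_exp (P : ℝ[X]) {δ : ℝ} (hδ : 0 < δ) :
    ∃ C : ℝ, 0 ≤ C ∧ ∀ u : ℝ, |P.eval u| ≤ C * Real.exp (δ * |u|) := by
  refine ⟨∑ k ∈ range (P.natDegree + 1), |P.coeff k| * (k.factorial / δ ^ k),
    Finset.sum_nonneg fun k _ => by positivity, fun u => ?_⟩
  rw [Polynomial.eval_eq_sum_range, Finset.sum_mul]
  refine (Finset.abs_sum_le_sum_abs _ _).trans (Finset.sum_le_sum fun k _ => ?_)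
  rw [abs_mul, abs_pow, mul_assoc]
  refine mul_le_mul_of_nonneg_left ?_ (abs_nonneg _)
  have h := Real.pow_div_factorial_le_exp (x := δ * |u|) (by positivity) k
  have hk : (0 : ℝ) < k.factorial := by exact_mod_cast k.factorial_pos
  rw [div_le_iff₀ hk, mul_pow] at h
  rw [div_mul_eq_mul_div, le_div_iff₀ (by positivity)]
  linarith

lemma exp_mul_abs_log_le (δ : ℝ) {y : ℝ} (hy : 0 < y) :
    Real.exp (δ * |Real.log y|) ≤ y ^ δ + y ^ (-δ) := by
  rw [Real.rpow_def_of_pos hy, Real.rpow_def_of_pos hy]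
  rcases abs_cases (Real.log y) with h | h <;> rw [h.1]
  · rw [mul_comm]
    exact le_add_of_nonneg_right (Real.exp_pos _).le
  · rw [mul_neg, mul_comm, ← mul_neg]
    exact le_add_of_nonneg_left (Real.exp_pos _).le

/-- Both powers are needed, since `y` may be small and `log y` very negative. -/
lemma Polynomial.exists_abs_mul_eval_log_le (P : ℝ[X]) {δ : ℝ} (hδ : 0 < δ) :
    ∃ C : ℝ, 0 ≤ C ∧ ∀ y : ℝ, 0 < y →
      |y * P.eval (Real.log y)| ≤ C * (y ^ (1 + δ) + y ^ (1 - δ)) := by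
  obtain ⟨C, hC, h⟩ := P.exists_abs_eval_le_exp hδ
  refine ⟨C, hC, fun y hy => ?_⟩
  rw [abs_mul, abs_of_pos hy, sub_eq_add_neg, Real.rpow_add hy, Real.rpow_add hy, Real.rpow_one,
    ← mul_add, mul_left_comm]
  exact mul_le_mul_of_nonneg_left ((h _).trans
    (mul_le_mul_of_nonneg_left (exp_mul_abs_log_le δ hy) hC)) hy.le

/-- Uniformity down to `y → 0` matters because `y = x / d i` with `d i` unbounded. For `y < 1` the
summatory function is zero and the error is the main term itself, which is `O(y ^ α)` because `α <
1`. -/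
lemma exists_abs_piltzSum_sub_le {t : ℕ} {P : ℝ[X]} {α : ℝ} (hα1 : α < 1)
    (h : (fun x : ℝ => piltzSum t x - x * P.eval (Real.log x)) =O[atTop] fun x : ℝ => x ^ α) :
    ∃ C : ℝ, 0 ≤ C ∧ ∀ y : ℝ, 0 < y → |piltzSum t y - y * P.eval (Real.log y)| ≤ C * y ^ α := by
  obtain ⟨C₁, hC₁, h₁⟩ := h.exists_nonneg
  obtain ⟨y₀, hy₀⟩ := eventually_atTop.1 (h₁.bound.and (eventually_ge_atTop 1))
  have hy₀1 := (hy₀ y₀ le_rfl).2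
  obtain ⟨C₂, hC₂, h₂⟩ := exists_piltzSum_le t (one_lt_two)
  -- With `δ = 1 - α` the smaller power `y ^ (1 - δ)` is exactly `y ^ α`.
  obtain ⟨C₃, hC₃, h₃⟩ := P.exists_abs_mul_eval_log_le (sub_pos.2 hα1)
  refine ⟨C₁ + (C₂ * y₀ ^ (2 - α) + C₃ * (y₀ ^ (2 * (1 - α)) + 1)), by positivity, fun y hy => ?_⟩
  rw [add_mul]
  have hyα : 0 < y ^ α := Real.rpow_pos_of_pos hy α
  by_cases hyy : y₀ ≤ y
  · have h4 := (hy₀ y hyy).1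
    rw [Real.norm_eq_abs, Real.norm_eq_abs, abs_of_pos hyα] at h4
    exact h4.trans (le_add_of_nonneg_right (by positivity))
  · push Not at hyy
    refine le_trans ?_ (le_add_of_nonneg_left (by positivity))
    refine (abs_sub _ _).trans ?_
    rw [add_mul]
    refine add_le_add ?_ ((h₃ y hy).trans ?_)
    · rw [abs_of_nonneg (piltzSum_nonneg t y), mul_assoc]
      refine (h₂ y hy.le).trans (mul_le_mul_of_nonneg_left ?_ hC₂)
      calc y ^ (2 : ℝ) = y ^ (2 - α) * y ^ α := by rw [← Real.rpow_add hy]; ring_nf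
        _ ≤ y₀ ^ (2 - α) * y ^ α := mul_le_mul_of_nonneg_right
          (Real.rpow_le_rpow hy.le hyy.le (by linarith)) hyα.le
    · rw [mul_assoc]
      refine mul_le_mul_of_nonneg_left ?_ hC₃
      calc y ^ (1 + (1 - α)) + y ^ (1 - (1 - α)) = (y ^ (2 * (1 - α)) + 1) * y ^ α := by
            rw [add_mul, one_mul, ← Real.rpow_add hy]; ring_nf
        _ ≤ (y₀ ^ (2 * (1 - α)) + 1) * y ^ α := mul_le_mul_of_nonneg_right
          (add_le_add_left (Real.rpow_le_rpow hy.le hyy.le (by linarith)) _) hyα.le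

/-! ### Admissible exponents in the Piltz divisor problem -/

lemma isBigO_rpow_rpow {a b : ℝ} (h : a ≤ b) :
    (fun x : ℝ => x ^ a) =O[atTop] fun x : ℝ => x ^ b := by
  refine IsBigO.of_bound 1 ?_
  filter_upwards [eventually_ge_atTop 1] with x hx
  have hx0 : 0 ≤ x := by linarith
  rw [one_mul, Real.norm_of_nonneg (Real.rpow_nonneg hx0 _),
    Real.norm_of_nonneg (Real.rpow_nonneg hx0 _)]
  exact Real.rpow_le_rpow_of_exponent_le hx h

lemma Polynomial.isBigO_mul_eval_log (P : ℝ[X]) (k : ℕ) {ε : ℝ} (hε : 0 < ε) :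
    (fun x : ℝ => x ^ k * P.eval (Real.log x)) =O[atTop] fun x : ℝ => x ^ ((k : ℝ) + ε) := by
  obtain ⟨C, hC, h⟩ := P.exists_abs_eval_le_exp hε
  refine IsBigO.of_bound C ?_
  filter_upwards [eventually_ge_atTop 1] with x hx
  have hx0 : 0 < x := by linarith
  have h1 := h (Real.log x)
  rw [abs_of_nonneg (Real.log_nonneg hx), mul_comm ε, ← Real.rpow_def_of_pos hx0] at h1
  rw [norm_mul, norm_pow, Real.norm_of_nonneg hx0.le, Real.norm_eq_abs,
    Real.norm_of_nonneg (Real.rpow_nonneg hx0.le _), Real.rpow_add hx0, Real.rpow_natCast,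
    mul_left_comm]
  exact mul_le_mul_of_nonneg_left h1 (by positivity)

lemma isBigO_piltzSum (t : ℕ) {ε : ℝ} (hε : 0 < ε) :
    piltzSum t =O[atTop] fun x : ℝ => x ^ (1 + ε) := by
  obtain ⟨C, -, h⟩ := exists_piltzSum_le t (lt_add_of_pos_right 1 hε)
  refine IsBigO.of_bound C ?_
  filter_upwards [eventually_ge_atTop 0] with x hx
  rw [Real.norm_of_nonneg (piltzSum_nonneg t x), Real.norm_of_nonneg (Real.rpow_nonneg hx _)]
  exact h x hx

lemma isPiltzAdmissible_one (t : ℕ) : IsPiltzAdmissible t 1 := by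
  have hf : (1 / ((t - 1).factorial : ℝ)) ≠ 0 :=
    one_div_ne_zero (Nat.cast_ne_zero.2 (Nat.factorial_ne_zero _))
  refine ⟨C (1 / ((t - 1).factorial : ℝ)) * X ^ (t - 1), natDegree_C_mul_X_pow _ _ hf,
    leadingCoeff_C_mul_X_pow _ _, fun ε hε => ?_⟩
  refine (isBigO_piltzSum t hε).sub ?_
  have h := (C (1 / ((t - 1).factorial : ℝ)) * X ^ (t - 1)).isBigO_mul_eval_log 1 hε
  simp only [pow_one, Nat.cast_one] at h
  exact h

lemma IsPiltzAdmissible.mono {t : ℕ} {θ θ' : ℝ} (h : IsPiltzAdmissible t θ) (hθ : θ ≤ θ') :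
    IsPiltzAdmissible t θ' := by
  obtain ⟨P, h1, h2, h3⟩ := h
  exact ⟨P, h1, h2, fun ε hε => (h3 ε hε).trans (isBigO_rpow_rpow (by linarith))⟩

lemma one_le_piltzTau {t n : ℕ} (ht : 1 ≤ t) (hn : n ≠ 0) : 1 ≤ piltzTau t n := by
  obtain ⟨t, rfl⟩ := Nat.exists_eq_add_of_le' ht
  rw [piltzTau, Nat.one_le_iff_ne_zero, ← Nat.pos_iff_ne_zero, Finset.card_pos]
  exact ⟨Fin.cons n fun _ => 1, Nat.mem_finMulAntidiag.2 ⟨by simp [Fin.prod_univ_succ], hn⟩⟩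

/-- For `θ < 0` the error would tend to `0`, but the summatory function jumps by at least `1` at
integers while the main term is continuous. -/
lemma IsPiltzAdmissible.nonneg {t : ℕ} (ht : 1 ≤ t) {θ : ℝ} (h : IsPiltzAdmissible t θ) :
    0 ≤ θ := by
  by_contra! hθ
  obtain ⟨P, -, -, h3⟩ := h
  have hO : (fun x : ℝ => piltzSum t x - x * P.eval (Real.log x)) =O[atTop]
      fun x : ℝ => x ^ (θ + -θ / 2) := h3 (-θ / 2) (by linarith)
  have hlim : Tendsto (fun x : ℝ => x ^ (θ + -θ / 2)) atTop (𝓝 0) := by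
    have : θ + -θ / 2 = -(-θ / 2) := by ring
    rw [this]
    exact tendsto_rpow_neg_atTop (by linarith)
  have hE := hO.trans_tendsto hlim
  -- Two errors and one variation of the main term, each below `1 / 4`, cannot add up to a jump of
  -- `1`.
  obtain ⟨x₀, hx₀⟩ := eventually_atTop.1 ((Metric.tendsto_nhds.1 hE) (1 / 4) (by norm_num))
  simp only [Real.dist_eq, sub_zero] at hx₀
  obtain ⟨n, hn⟩ := exists_nat_ge (max x₀ 1)
  have hnx : x₀ ≤ n := (le_max_left _ _).trans hn
  have hn1 : (1 : ℝ) ≤ n := (le_max_right _ _).trans hn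
  have hcont : ContinuousAt (fun x : ℝ => x * P.eval (Real.log x)) ((n + 1 : ℕ) : ℝ) := by
    refine continuousAt_id.mul (P.continuous.continuousAt.comp (Real.continuousAt_log ?_))
    positivity
  obtain ⟨δ, hδ, hd⟩ := Metric.continuousAt_iff.1 hcont (1 / 4) (by norm_num)
  simp only [Real.dist_eq] at hd
  have hm : 0 < min (δ / 2) 1 := by positivity
  have hm1 : min (δ / 2) 1 ≤ 1 := min_le_right _ _
  have hm2 : min (δ / 2) 1 ≤ δ / 2 := min_le_left _ _
  set η := min (δ / 2) 1
  have hd' := hd (x := ((n + 1 : ℕ) : ℝ) - η) (by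
    rw [sub_sub_cancel_left, abs_neg, abs_of_pos hm]; linarith)
  have e1 := hx₀ ((n + 1 : ℕ) : ℝ) (by push_cast; linarith)
  have e2 := hx₀ (((n + 1 : ℕ) : ℝ) - η) (by push_cast; linarith)
  have hfl : ⌊((n + 1 : ℕ) : ℝ) - η⌋₊ = n := by
    rw [Nat.floor_eq_iff (by push_cast; linarith)]
    constructor <;> push_cast <;> linarith
  have hS : piltzSum t ((n + 1 : ℕ) : ℝ) =
      piltzSum t (((n + 1 : ℕ) : ℝ) - η) + piltzTau t (n + 1) := by
    rw [piltzSum, piltzSum, hfl, Nat.floor_natCast, Finset.sum_Icc_succ_top (by omega)]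
  have hτ : (1 : ℝ) ≤ piltzTau t (n + 1) := by
    exact_mod_cast one_le_piltzTau ht (Nat.succ_ne_zero n)
  rw [abs_lt] at e1 e2 hd'
  linarith

lemma piltzExponent_nonneg {t : ℕ} (ht : 1 ≤ t) : 0 ≤ piltzExponent t :=
  Real.sInf_nonneg fun _ h => IsPiltzAdmissible.nonneg ht h

lemma isPiltzAdmissible_of_piltzExponent_lt {t : ℕ} {θ : ℝ} (h : piltzExponent t < θ) :
    IsPiltzAdmissible t θ := by
  obtain ⟨θ', h1, h2⟩ := exists_lt_of_csInf_lt ⟨1, isPiltzAdmissible_one t⟩ h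
  exact IsPiltzAdmissible.mono h1 h2.le

/-- Dividing by `x` gives `P (log x) → 0`, and only the zero polynomial tends to `0` at infinity.
Below exponent `1` this makes the polynomial in the Piltz problem unique. -/
lemma Polynomial.eq_zero_of_isBigO_mul_eval_log {P : ℝ[X]} {β : ℝ} (hβ : β < 1)
    (h : (fun x : ℝ => x * P.eval (Real.log x)) =O[atTop] fun x : ℝ => x ^ β) : P = 0 := by
  have h1 : (fun x : ℝ => P.eval (Real.log x)) =O[atTop] fun x : ℝ => x ^ (β - 1) := by
    refine ((isBigO_refl (fun x : ℝ => x⁻¹) atTop).mul h).congr' ?_ ?_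
    · filter_upwards [eventually_gt_atTop 0] with x hx
      field_simp
    · filter_upwards [eventually_gt_atTop 0] with x hx
      rw [Real.rpow_sub hx, Real.rpow_one, div_eq_inv_mul]
  have h2 : Tendsto (fun x : ℝ => x ^ (β - 1)) atTop (𝓝 0) := by
    rw [← neg_sub]
    exact tendsto_rpow_neg_atTop (by linarith)
  have h3 := (h1.trans_tendsto h2).comp Real.tendsto_exp_atTop
  have h4 : Tendsto (fun x => P.eval x) atTop (𝓝 0) := h3.congr fun x => by simp
  exact leadingCoeff_eq_zero.1 (P.tendsto_nhds_iff.1 h4).1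

/-- If the exponent `ϑ_t` is less than `1`, one polynomial serves for all error terms. -/
lemma exists_polynomial_piltzSum {t : ℕ} (h : piltzExponent t < 1) :
    ∃ P : ℝ[X], P.natDegree = t - 1 ∧ P.leadingCoeff = 1 / ((t - 1).factorial : ℝ) ∧
      ∀ α : ℝ, piltzExponent t < α →
        (fun x : ℝ => piltzSum t x - x * P.eval (Real.log x)) =O[atTop] fun x : ℝ => x ^ α := by
  obtain ⟨θ, hθ, hθ1⟩ := exists_between h
  obtain ⟨P, hP1, hP2, hP3⟩ := isPiltzAdmissible_of_piltzExponent_lt hθ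
  refine ⟨P, hP1, hP2, fun α hα => ?_⟩
  obtain ⟨θ', hθ', hθ1'⟩ := exists_between (lt_min hα hθ)
  rw [lt_min_iff] at hθ1'
  obtain ⟨P', -, -, hP3'⟩ := isPiltzAdmissible_of_piltzExponent_lt hθ'
  have hO := hP3 ((1 - θ) / 2) (by linarith)
  have hO' := (hP3' ((1 - θ) / 2) (by linarith)).trans
    (isBigO_rpow_rpow (b := θ + (1 - θ) / 2) (by linarith))
  -- Admissibility supplies a polynomial for each exponent separately. Both `P` and `P'` have error
  -- exponent at most `(1 + θ) / 2 < 1`, so they coincide.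
  have hPP : P' - P = 0 := by
    refine Polynomial.eq_zero_of_isBigO_mul_eval_log (β := θ + (1 - θ) / 2) (by linarith)
      ((hO.sub hO').congr_left fun x => ?_)
    rw [eval_sub]
    ring
  rw [← sub_eq_zero.1 hPP]
  have := hP3' (α - θ') (by linarith)
  rwa [add_sub_cancel] at this

/-! ### Infinite sums of polynomials of bounded degree -/

/-- A family of polynomials of bounded degree that is summable at every nonnegative point sums to
a polynomial. -/
lemma Polynomial.exists_eval_eq_tsum {κ : Type*} (p : κ → ℝ[X]) (D : ℕ)
    (hdeg : ∀ d, (p d).natDegree ≤ D) (hs : ∀ x : ℝ, 0 ≤ x → Summable fun d => (p d).eval x) :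
    ∃ Q : ℝ[X], Q.natDegree ≤ D ∧ (∀ x : ℝ, 0 ≤ x → Q.eval x = ∑' d, (p d).eval x) ∧
      Q.coeff D = ∑' d, (p d).coeff D := by
  have hinj : Set.InjOn (fun n : ℕ => (n : ℝ)) (range (D + 1) : Finset ℕ) :=
    Nat.cast_injective.injOn
  -- Interpolation at `0, …, D` expresses all coefficients linearly through `D + 1` values, so
  -- pointwise summability passes to the coefficients.
  set b := Lagrange.basis (range (D + 1)) (fun n : ℕ => (n : ℝ))
  have hp : ∀ d, p d = ∑ i ∈ range (D + 1), C ((p d).eval (i : ℝ)) * b i := fun d => by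
    conv_lhs => rw [Lagrange.eq_interpolate hinj (f := p d) (by
      rw [Finset.card_range]
      exact (degree_le_of_natDegree_le (hdeg d)).trans_lt (by exact_mod_cast Nat.lt_succ_self D))]
    rfl
  have hs' : ∀ i : ℕ, Summable fun d => (p d).eval (i : ℝ) := fun i => hs i (Nat.cast_nonneg i)
  refine ⟨∑ i ∈ range (D + 1), C (∑' d, (p d).eval (i : ℝ)) * b i, ?_, fun x _ => ?_, ?_⟩
  · refine natDegree_sum_le_of_forall_le _ _ fun i hi => (natDegree_C_mul_le _ _).trans ?_
    rw [Lagrange.natDegree_basis hinj hi, Finset.card_range, Nat.add_sub_cancel]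
  · have h1 : ∀ d, (p d).eval x = ∑ i ∈ range (D + 1), (p d).eval (i : ℝ) * (b i).eval x :=
      fun d => by conv_lhs => rw [hp d, eval_finsetSum]; simp only [eval_mul, eval_C]
    simp only [h1]
    rw [Summable.tsum_finsetSum fun i _ => (hs' i).mul_right _, eval_finsetSum]
    simp only [eval_mul, eval_C, tsum_mul_right]
  · have h1 : ∀ d, (p d).coeff D = ∑ i ∈ range (D + 1), (p d).eval (i : ℝ) * (b i).coeff D :=
      fun d => by conv_lhs => rw [hp d, finsetSum_coeff]; simp only [coeff_C_mul]
    simp only [h1]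
    rw [Summable.tsum_finsetSum fun i _ => (hs' i).mul_right _, finsetSum_coeff]
    simp only [coeff_C_mul, tsum_mul_right]

/-- Telescoping: the factors are exchanged one at a time. -/
lemma Finset.abs_prod_sub_prod_le {κ : Type*} [DecidableEq κ] (s : Finset κ) {a b B E : κ → ℝ}
    (ha : ∀ i, |a i| ≤ B i) (hb : ∀ i, |b i| ≤ B i) (hE : ∀ i, |a i - b i| ≤ E i) :
    |∏ i ∈ s, a i - ∏ i ∈ s, b i| ≤ ∑ k ∈ s, E k * ∏ i ∈ s.erase k, B i := by
  have hB : ∀ i, 0 ≤ B i := fun i => (abs_nonneg _).trans (ha i)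
  induction s using Finset.induction_on with
  | empty => simp
  | insert q s hq ih =>
    rw [Finset.prod_insert hq, Finset.prod_insert hq, Finset.sum_insert hq, Finset.erase_insert hq]
    have h1 : ∀ k ∈ s, E k * ∏ i ∈ (insert q s).erase k, B i =
        B q * (E k * ∏ i ∈ s.erase k, B i) := fun k hk => by
      rw [Finset.erase_insert_of_ne (by rintro rfl; exact hq hk),
        Finset.prod_insert (fun h => hq (Finset.mem_of_mem_erase h))]
      ring
    rw [Finset.sum_congr rfl h1, ← Finset.mul_sum]
    have h2 : a q * ∏ i ∈ s, a i - b q * ∏ i ∈ s, b i =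
        (a q - b q) * ∏ i ∈ s, a i + b q * (∏ i ∈ s, a i - ∏ i ∈ s, b i) := by ring
    rw [h2]
    refine (abs_add_le _ _).trans (add_le_add ?_ ?_)
    · rw [abs_mul, Finset.abs_prod]
      exact mul_le_mul (hE q) (Finset.prod_le_prod (fun _ _ => abs_nonneg _) fun i _ => ha i)
        (Finset.prod_nonneg fun _ _ => abs_nonneg _) ((abs_nonneg _).trans (hE q))
    · rw [abs_mul]
      exact mul_le_mul (hb q) ih (abs_nonneg _) (hB q)

/-! ### Summation of the convolution -/

lemma exists_abs_le_rpow_mul_rpow (t : ℕ) (P : ℝ[X]) {δ : ℝ} (hδ : 0 < δ) :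
    ∃ B : ℝ, 0 ≤ B ∧ ∀ (x : ℝ) (d : ℕ), 1 ≤ x → d ≠ 0 →
      |piltzSum t (x / d)| ≤ B * x ^ (1 + δ) * (d : ℝ) ^ (-(1 - δ)) ∧
      |x / d * P.eval (Real.log (x / d))| ≤ B * x ^ (1 + δ) * (d : ℝ) ^ (-(1 - δ)) := by
  obtain ⟨C₁, hC₁, h₁⟩ := exists_piltzSum_le t (lt_add_of_pos_right 1 hδ)
  obtain ⟨C₂, hC₂, h₂⟩ := P.exists_abs_mul_eval_log_le hδ
  refine ⟨C₁ + 2 * C₂, by positivity, fun x d hx hd => ?_⟩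
  have hx0 : 0 < x := by linarith
  have hd1 : (1 : ℝ) ≤ d := by exact_mod_cast Nat.one_le_iff_ne_zero.2 hd
  have hd0 : (0 : ℝ) < d := by linarith
  have hpos : 0 ≤ x ^ (1 + δ) * (d : ℝ) ^ (-(1 - δ)) := by positivity
  have e1 : (x / d) ^ (1 + δ) ≤ x ^ (1 + δ) * (d : ℝ) ^ (-(1 - δ)) := by
    rw [Real.div_rpow hx0.le hd0.le, div_eq_mul_inv, ← Real.rpow_neg hd0.le]
    exact mul_le_mul_of_nonneg_left (Real.rpow_le_rpow_of_exponent_le hd1 (by linarith))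
      (by positivity)
  have e2 : (x / d) ^ (1 - δ) ≤ x ^ (1 + δ) * (d : ℝ) ^ (-(1 - δ)) := by
    rw [Real.div_rpow hx0.le hd0.le, div_eq_mul_inv, ← Real.rpow_neg hd0.le]
    exact mul_le_mul_of_nonneg_right (Real.rpow_le_rpow_of_exponent_le hx (by linarith))
      (by positivity)
  rw [mul_assoc]
  constructor
  · rw [abs_of_nonneg (piltzSum_nonneg _ _)]
    refine (h₁ _ (by positivity)).trans ((mul_le_mul_of_nonneg_left e1 hC₁).trans ?_)
    exact mul_le_mul_of_nonneg_right (by linarith) hpos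
  · refine (h₂ _ (by positivity)).trans
      ((mul_le_mul_of_nonneg_left (add_le_add e1 e2) hC₂).trans ?_)
    rw [← two_mul, ← mul_assoc, mul_comm C₂]
    exact mul_le_mul_of_nonneg_right (by linarith) hpos

section MainTerm

variable {ι : Type*} [Fintype ι]

lemma coprimeTerm_eq_zero (t : ι → ℕ) (s : ι → ℝ) {d : ι → ℕ} {i : ι} (hi : d i = 0) :
    coprimeTerm t s d = 0 := by
  rw [coprimeTerm, coprimeCoeff_eq_zero t hi, zero_mul]

lemma natDegree_prod_comp_X_sub_C {P : ι → ℝ[X]} (hP : ∀ i, P i ≠ 0) (c : ι → ℝ) :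
    (∏ i, (P i).comp (X - C (c i))).natDegree = ∑ i, (P i).natDegree := by
  rw [natDegree_prod]
  · simp [natDegree_comp]
  · intro i _ h
    rw [← leadingCoeff_eq_zero, leadingCoeff_comp (by simp)] at h
    simp at h
    exact hP i h

lemma leadingCoeff_prod_comp_X_sub_C (P : ι → ℝ[X]) (c : ι → ℝ) :
    (∏ i, (P i).comp (X - C (c i))).leadingCoeff = ∏ i, (P i).leadingCoeff := by
  rw [leadingCoeff_prod]
  refine Finset.prod_congr rfl fun i _ => ?_
  rw [leadingCoeff_comp (by simp)]
  simp

/-- The polynomial that the tuple `d` contributes to the main term. -/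
noncomputable def mainTermPolynomial (t : ι → ℕ) (P : ι → ℝ[X]) (d : ι → ℕ) : ℝ[X] :=
  C (coprimeTerm t (fun _ => 1) d) * ∏ i, (P i).comp (X - C (Real.log (d i)))

lemma pow_card_mul_eval_mainTermPolynomial (t : ι → ℕ) (P : ι → ℝ[X]) (d : ι → ℕ) {x : ℝ}
    (hx : 0 < x) :
    x ^ Fintype.card ι * (mainTermPolynomial t P d).eval (Real.log x) =
      coprimeCoeff t d * ∏ i, (x / d i * (P i).eval (Real.log (x / d i))) := by
  by_cases h0 : ∃ i, d i = 0
  · obtain ⟨i, hi⟩ := h0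
    rw [mainTermPolynomial, coprimeCoeff_eq_zero t hi, coprimeTerm_eq_zero t _ hi]
    simp
  · push Not at h0
    rw [mainTermPolynomial, coprimeTerm, eval_mul, eval_C, eval_prod, mul_assoc, mul_left_comm,
      ← Finset.prod_mul_distrib, ← Finset.card_univ, ← Finset.prod_const,
      ← Finset.prod_mul_distrib]
    congr 1
    refine Finset.prod_congr rfl fun i _ => ?_
    rw [eval_comp, eval_sub, eval_X, eval_C, Real.rpow_neg_one,
      Real.log_div hx.ne' (Nat.cast_ne_zero.2 (h0 i))]
    ring

variable [DecidableEq ι]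

lemma summable_coprimeCoeff_mul_prod (t : ι → ℕ) {δ : ℝ} (hδ : δ < 1 / 2)
    (B : ι → ℝ) (f : ι → ℕ → ℝ)
    (hf : ∀ i (d : ℕ), d ≠ 0 → |f i d| ≤ B i * (d : ℝ) ^ (-(1 - δ))) :
    Summable fun d : ι → ℕ => coprimeCoeff t d * ∏ i, f i (d i) := by
  have hs := summable_coprimeTerm t (s := fun _ => 1 - δ) (fun _ => by linarith)
    (σ := 1 - δ + (1 - δ)) (by linarith) (fun _ _ _ => le_rfl)
  refine Summable.of_norm_bounded (hs.mul_left (∏ i, B i)) fun d => ?_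
  rw [Real.norm_eq_abs, abs_mul, Finset.abs_prod]
  by_cases h0 : ∃ i, d i = 0
  · obtain ⟨i, hi⟩ := h0
    rw [coprimeCoeff_eq_zero t hi, coprimeTerm_eq_zero t _ hi]
    simp
  · push Not at h0
    rw [coprimeTerm, abs_mul, mul_left_comm, abs_of_nonneg (a := ∏ i, (d i : ℝ) ^ (-(1 - δ)))
      (by positivity), ← Finset.prod_mul_distrib]
    exact mul_le_mul_of_nonneg_left (Finset.prod_le_prod (fun _ _ => abs_nonneg _)
      fun i _ => hf i (d i) (h0 i)) (abs_nonneg _)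

/-- Shifting the argument by `log (d i)` changes neither degree nor leading coefficient, so every
`d` contributes to the top coefficient only through `coprimeTerm t (fun _ => 1) d`. -/
lemma exists_mainTerm (t : ι → ℕ) {P : ι → ℝ[X]} (hP : ∀ i, P i ≠ 0) :
    ∃ Q : ℝ[X], Q.natDegree ≤ ∑ i, (P i).natDegree ∧
      (∀ x : ℝ, 1 ≤ x → x ^ Fintype.card ι * Q.eval (Real.log x) =
        ∑' d : ι → ℕ, coprimeCoeff t d * ∏ i, (x / d i * (P i).eval (Real.log (x / d i)))) ∧
      Q.coeff (∑ i, (P i).natDegree) =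
        (∑' d, coprimeTerm t (fun _ => 1) d) * ∏ i, (P i).leadingCoeff := by
  have hsum : ∀ x : ℝ, 1 ≤ x → Summable fun d : ι → ℕ =>
      coprimeCoeff t d * ∏ i, (x / d i * (P i).eval (Real.log (x / d i))) := fun x hx => by
    choose B hB h using fun i => exists_abs_le_rpow_mul_rpow (t i) (P i)
      (show (0 : ℝ) < 1 / 4 by norm_num)
    exact summable_coprimeCoeff_mul_prod t (by norm_num) (fun i => B i * x ^ (1 + 1 / 4 : ℝ))
      (fun i n => x / n * (P i).eval (Real.log (x / n))) fun i n hn => (h i x n hx hn).2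
  obtain ⟨Q, hQ1, hQ2, hQ3⟩ := Polynomial.exists_eval_eq_tsum (mainTermPolynomial t P)
    (∑ i, (P i).natDegree) (fun d => (natDegree_C_mul_le _ _).trans
      (natDegree_prod_comp_X_sub_C hP _).le) (fun u hu => by
      refine ((hsum (Real.exp u) (Real.one_le_exp hu)).mul_left
        ((Real.exp u ^ Fintype.card ι)⁻¹)).congr fun d => ?_
      rw [← pow_card_mul_eval_mainTermPolynomial t P d (Real.exp_pos u), Real.log_exp,
        inv_mul_cancel_left₀ (by positivity)])
  refine ⟨Q, hQ1, fun x hx => ?_, ?_⟩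
  · rw [hQ2 _ (Real.log_nonneg hx), ← tsum_mul_left]
    exact tsum_congr fun d => pow_card_mul_eval_mainTermPolynomial t P d (by linarith)
  · rw [hQ3, ← tsum_mul_right]
    refine tsum_congr fun d => ?_
    rw [mainTermPolynomial, coeff_C_mul, ← natDegree_prod_comp_X_sub_C hP
      (fun i => Real.log (d i)), coeff_natDegree, leadingCoeff_prod_comp_X_sub_C]

/-- The error made by replacing every `piltzSum` by its main term. -/
lemma exists_abs_tsum_sub_tsum_le (t : ι → ℕ) (P : ι → ℝ[X]) {α δ : ℝ} (hα1 : α < 1)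
    (hδ0 : 0 < δ) (hδ : δ < 1 / 2) (hδα : δ < α)
    (hP : ∀ i, (fun x : ℝ => piltzSum (t i) x - x * (P i).eval (Real.log x)) =O[atTop]
      fun x : ℝ => x ^ α) :
    ∃ K : ℝ, ∀ x : ℝ, 1 ≤ x →
      |(∑' d : ι → ℕ, coprimeCoeff t d * ∏ i, piltzSum (t i) (x / d i)) -
        ∑' d : ι → ℕ, coprimeCoeff t d * ∏ i, (x / d i * (P i).eval (Real.log (x / d i)))| ≤
      K * x ^ (α + ((Fintype.card ι : ℝ) - 1) * (1 + δ)) := by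
  choose B hB hBd using fun i => exists_abs_le_rpow_mul_rpow (t i) (P i) hδ0
  choose E hE hEd using fun i => exists_abs_piltzSum_sub_le hα1 (hP i)
  -- In the `k`-th telescoping term coordinate `k` carries the error `(x / d k) ^ α` and the others
  -- the trivial bound. Pairwise sums of exponents are at least `α + 1 - δ` or `2 - 2δ`, both above
  -- `1` by `δ < α` and `δ < 1 / 2`.
  let s : ι → ι → ℝ := fun k => Function.update (fun _ => 1 - δ) k α
  have hs0 : ∀ k i, 0 ≤ s k i := fun k i => by
    simp only [s, Function.update_apply]
    split_ifs <;> linarith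
  have hss : ∀ k, Summable fun d => |coprimeTerm t (s k) d| := fun k =>
    summable_coprimeTerm t (hs0 k) (σ := min (α + (1 - δ)) (1 - δ + (1 - δ)))
      (lt_min (by linarith) (by linarith)) fun i j hij => by
        simp only [s, Function.update_apply]
        split_ifs with h1 h2 h2
        · exact absurd (h1.trans h2.symm) hij
        · exact min_le_left _ _
        · exact (min_le_left _ _).trans (by linarith)
        · exact min_le_right _ _
  refine ⟨∑ k, E k * (∏ i ∈ univ.erase k, B i) * ∑' d, |coprimeTerm t (s k) d|, fun x hx => ?_⟩
  have hx0 : 0 < x := by linarith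
  have hsum1 := summable_coprimeCoeff_mul_prod t hδ (fun i => B i * x ^ (1 + δ))
    (fun i n => piltzSum (t i) (x / n)) fun i n hn => (hBd i x n hx hn).1
  have hsum2 := summable_coprimeCoeff_mul_prod t hδ (fun i => B i * x ^ (1 + δ))
    (fun i n => x / n * (P i).eval (Real.log (x / n))) fun i n hn => (hBd i x n hx hn).2
  rw [← hsum1.tsum_sub hsum2]
  set y := x ^ (α + ((Fintype.card ι : ℝ) - 1) * (1 + δ))
  have hbound : ∀ d : ι → ℕ, ‖coprimeCoeff t d * ∏ i, piltzSum (t i) (x / d i) -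
      coprimeCoeff t d * ∏ i, (x / d i * (P i).eval (Real.log (x / d i)))‖ ≤
      ∑ k, E k * (∏ i ∈ univ.erase k, B i) * y * |coprimeTerm t (s k) d| := fun d => by
    rw [Real.norm_eq_abs, ← mul_sub, abs_mul]
    by_cases h0 : ∃ i, d i = 0
    · obtain ⟨i, hi⟩ := h0
      rw [coprimeCoeff_eq_zero t hi]
      simp only [coprimeTerm_eq_zero t _ hi]
      simp
    · push Not at h0
      have h1 := Finset.abs_prod_sub_prod_le univ
        (a := fun i => piltzSum (t i) (x / d i))
        (b := fun i => x / d i * (P i).eval (Real.log (x / d i)))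
        (B := fun i => B i * x ^ (1 + δ) * (d i : ℝ) ^ (-(1 - δ)))
        (E := fun i => E i * (x / d i) ^ α)
        (fun i => (hBd i x (d i) hx (h0 i)).1) (fun i => (hBd i x (d i) hx (h0 i)).2)
        (fun i => hEd i _ (div_pos hx0 (Nat.cast_pos.2 (Nat.pos_of_ne_zero (h0 i)))))
      refine (mul_le_mul_of_nonneg_left h1 (abs_nonneg _)).trans (le_of_eq ?_)
      rw [Finset.mul_sum]
      refine Finset.sum_congr rfl fun k _ => ?_
      have h2 : ∏ i, (d i : ℝ) ^ (-s k i) =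
          (d k : ℝ) ^ (-α) * ∏ i ∈ univ.erase k, (d i : ℝ) ^ (-(1 - δ)) := by
        rw [← Finset.mul_prod_erase _ _ (Finset.mem_univ k)]
        simp only [s, Function.update_self]
        congr 1
        refine Finset.prod_congr rfl fun i hi => ?_
        rw [Function.update_of_ne (Finset.ne_of_mem_erase hi)]
      have hy : y = x ^ α * (x ^ (1 + δ)) ^ (#(univ.erase k)) := by
        rw [Finset.card_erase_of_mem (Finset.mem_univ k), Finset.card_univ, ← Real.rpow_natCast,
          ← Real.rpow_mul hx0.le, ← Real.rpow_add hx0,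
          Nat.cast_sub (Fintype.card_pos_iff.2 ⟨k⟩), Nat.cast_one, mul_comm (1 + δ)]
      rw [coprimeTerm, abs_mul, abs_of_nonneg (a := ∏ i, (d i : ℝ) ^ (-s k i)) (by positivity), h2,
        Finset.prod_mul_distrib, Finset.prod_mul_distrib, Finset.prod_const,
        Real.div_rpow hx0.le (Nat.cast_nonneg _), Real.rpow_neg (Nat.cast_nonneg (d k)), hy]
      ring
  have hsb : Summable fun d => ∑ k, E k * (∏ i ∈ univ.erase k, B i) * y * |coprimeTerm t (s k) d| :=
    summable_sum fun k _ => (hss k).mul_left _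
  refine (tsum_of_norm_bounded hsb.hasSum hbound).trans (le_of_eq ?_)
  rw [Summable.tsum_finsetSum fun k _ => (hss k).mul_left _, Finset.sum_mul]
  refine Finset.sum_congr rfl fun k _ => ?_
  rw [tsum_mul_left]
  ring

end MainTerm

/-! ### The trivial bound and the asymptotic formula. -/

lemma pairwiseCoprimeTauSum_nonneg {r : ℕ} (t : Fin r → ℕ) (x : ℝ) :
    0 ≤ pairwiseCoprimeTauSum t x :=
  Finset.sum_nonneg fun _ _ => Finset.prod_nonneg fun _ _ => Nat.cast_nonneg _

lemma pairwiseCoprimeTauSum_le {r : ℕ} (t : Fin r → ℕ) (x : ℝ) :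
    pairwiseCoprimeTauSum t x ≤ ∏ i, piltzSum (t i) x := by
  simp only [piltzSum]
  rw [Finset.prod_univ_sum]
  exact Finset.sum_le_sum_of_subset_of_nonneg (Finset.filter_subset _ _)
    fun _ _ _ => Finset.prod_nonneg fun _ _ => Nat.cast_nonneg _

lemma isBigO_pairwiseCoprimeTauSum {r : ℕ} (hr : 0 < r) (t : Fin r → ℕ) {ε : ℝ} (hε : 0 < ε) :
    pairwiseCoprimeTauSum t =O[atTop] fun x : ℝ => x ^ ((r : ℝ) + ε) := by
  have hr' : (0 : ℝ) < r := Nat.cast_pos.2 hr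
  choose C hC h using fun i => exists_piltzSum_le (t i) (lt_add_of_pos_right 1 (div_pos hε hr'))
  refine IsBigO.of_bound (∏ i, C i) ?_
  filter_upwards [eventually_ge_atTop 0] with x hx
  rw [Real.norm_of_nonneg (pairwiseCoprimeTauSum_nonneg t x),
    Real.norm_of_nonneg (Real.rpow_nonneg hx _)]
  refine (pairwiseCoprimeTauSum_le t x).trans ((Finset.prod_le_prod
    (fun i _ => piltzSum_nonneg _ _) fun i _ => h i x hx).trans (le_of_eq ?_))
  rw [Finset.prod_mul_distrib, Finset.prod_const, Finset.card_univ, Fintype.card_fin,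
    ← Real.rpow_natCast, ← Real.rpow_mul hx]
  congr 2
  field_simp

theorem theorem5 (r : ℕ) (hr : 2 ≤ r) (t : Fin r → ℕ) (ht : ∀ i, 2 ≤ t i) :
    Multipliable (fun p : Nat.Primes => deltaBarFactor t (p : ℕ)) ∧
    ∃ Q : ℝ[X],
      Q.natDegree = (∑ i, t i) - r ∧
      Q.leadingCoeff = deltaBar t / ∏ i, ((t i - 1).factorial : ℝ) ∧
      ∀ ε : ℝ, 0 < ε →
        (fun x : ℝ => pairwiseCoprimeTauSum t x - x ^ r * Q.eval (Real.log x))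
          =O[atTop] fun x : ℝ => x ^ ((r : ℝ) - 1 + (⨆ i, piltzExponent (t i)) + ε) := by
  refine ⟨(hasProd_deltaBarFactor t).multipliable, ?_⟩
  have hc : deltaBar t / ∏ i, ((t i - 1).factorial : ℝ) ≠ 0 :=
    div_ne_zero (deltaBar_pos t).ne'
      (Finset.prod_ne_zero_iff.2 fun i _ => Nat.cast_ne_zero.2 (Nat.factorial_ne_zero _))
  have hr0 : (0 : ℝ) < r := by positivity
  set M := ⨆ i, piltzExponent (t i)
  have hM : ∀ i, piltzExponent (t i) ≤ M := fun i => 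
    le_ciSup (f := fun i => piltzExponent (t i)) (Set.finite_range _).bddAbove i
  have hM0 : 0 ≤ M :=
    (piltzExponent_nonneg (by have := ht ⟨0, by omega⟩; omega)).trans (hM ⟨0, by omega⟩)
  -- For `M ≥ 1` the allowed error is at least `x ^ (r + ε)`, which dominates both the sum and the
  -- chosen monomial main term.
  rcases le_or_gt 1 M with h1 | h1
  · refine ⟨C (deltaBar t / ∏ i, ((t i - 1).factorial : ℝ)) * X ^ ((∑ i, t i) - r),
      natDegree_C_mul_X_pow _ _ hc, leadingCoeff_C_mul_X_pow _ _, fun ε hε => ?_⟩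
    exact ((isBigO_pairwiseCoprimeTauSum (by omega) t hε).sub (Polynomial.isBigO_mul_eval_log _ r hε)).trans
      (isBigO_rpow_rpow (by linarith))
  · choose P hP1 hP2 hP3 using fun i => exists_polynomial_piltzSum ((hM i).trans_lt h1)
    have hP0 : ∀ i, P i ≠ 0 := fun i h => by
      have := hP2 i
      rw [h, leadingCoeff_zero] at this
      exact (one_div_ne_zero (Nat.cast_ne_zero.2 (Nat.factorial_ne_zero _))) this.symm
    obtain ⟨Q, hQ1, hQ2, hQ3⟩ := exists_mainTerm t hP0
    have hD : ∑ i, (P i).natDegree = (∑ i, t i) - r := by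
      have : ∑ i, (P i).natDegree + r = ∑ i, t i := by
        have h2 : ∑ _i : Fin r, 1 = r := by simp
        refine (congrArg (_ + ·) h2.symm).trans ?_
        rw [← Finset.sum_add_distrib]
        refine Finset.sum_congr rfl fun i _ => ?_
        have := ht i
        rw [hP1 i]
        omega
      omega
    have hlc : Q.coeff (∑ i, (P i).natDegree) =
        deltaBar t / ∏ i, ((t i - 1).factorial : ℝ) := by
      rw [hQ3, ← deltaBar_eq_tsum]
      simp only [hP2]
      rw [Finset.prod_div_distrib, Finset.prod_const_one, mul_one_div]
    have hdeg : Q.natDegree = ∑ i, (P i).natDegree :=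
      le_antisymm hQ1 (le_natDegree_of_ne_zero (by rw [hlc]; exact hc))
    refine ⟨Q, hdeg.trans hD, by rw [leadingCoeff, hdeg, hlc], fun ε hε => ?_⟩
    -- Half of `ε` is spent on `α`; the other half covers `(r - 1) δ`, since `δ < ε / (2 r)`.
    -- Positivity of `α`, which makes `δ < α` possible, comes from `M ≥ 0`.
    obtain ⟨α, hα, hα'⟩ := exists_between (lt_min h1 (show M < M + ε / 2 by linarith))
    rw [lt_min_iff] at hα'
    have hα0 : 0 < α := hM0.trans_lt hα
    obtain ⟨δ, hδ0, hδ⟩ := exists_between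
      (lt_min (lt_min (one_half_pos (α := ℝ)) hα0) (show 0 < ε / (2 * r) by positivity))
    rw [lt_min_iff, lt_min_iff] at hδ
    have hδε := (lt_div_iff₀ (by positivity)).1 hδ.2
    obtain ⟨K, hK⟩ := exists_abs_tsum_sub_tsum_le t P hα'.1 hδ0 hδ.1.1 hδ.1.2
      fun i => hP3 i α ((hM i).trans_lt hα)
    refine IsBigO.trans (IsBigO.of_bound K ?_) (isBigO_rpow_rpow
      (a := α + ((Fintype.card (Fin r) : ℝ) - 1) * (1 + δ)) ?_)
    · filter_upwards [eventually_ge_atTop 1] with x hx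
      have h2 := hK x hx
      rw [← pairwiseCoprimeTauSum_eq_tsum, ← hQ2 x hx] at h2
      rw [Real.norm_eq_abs, Real.norm_of_nonneg (Real.rpow_nonneg (by linarith) _)]
      simpa only [Fintype.card_fin] using h2
    · rw [Fintype.card_fin]
      nlinarith
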